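/- A graph means a finite connected oriented graph $G$ with vertex set $V$ and edge set $E$; multiple edges and loops are allowed. (The orientation is auxiliary.) Let $\partial\colon \mathbb Z^E\to\mathbb Z^V$, $\partial e=\operatorname{end}(e)-\operatorname{beg}(e)$, let $d\colon \mathbb Z^V\to\mathbb Z^E$, $(df)(e)=f(\operatorname{end}(e))-f(\operatorname{beg}(e))$, and put $H_1(G,\mathbb Z)=\ker\partial$, $H^1(G,\mathbb Z)=\operatorname{coker} d$. The genus of $G$ is the rank of $H_1(G,\mathbb Z)$. For $e\in E$ let $e^*\in H^1(G,\mathbb Z)$ be its class; $e^*=0$ if and only if $e$ is a bridge. A $\mathbb Z$-edge-minimizing metric ($\mathbb Z$-emm) on $G$ is an integral quadratic form $q\in \operatorname{Sym}^2H_1(G,\mathbb Z)$ on $H^1(G,\mathbb Z)$ such that $q$ is positive definite, $q(e^*)=1$ for every edge $e$ that is not a bridge, and $q(v^*)\ge 1$ for every $v^*\in H^1(G,\mathbb Z)\setminus 0$. A graph is called stable if every vertex has valence at least $3$ (loops count twice). For $g\ge 1$ let $M$ be the lattice of symmetric half-integral $g\times g$ matrices (integral diagonal entries, off-diagonal entries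 in $\frac12\mathbb Z$), let $C$ be the cone of positive definite real symmetric $g\times g$ matrices, and let $Q$ be the convex hull of $C\cap (M\setminus 0)$. The central cones fan $\tau^{\mathrm{cent}}$ (the fan that defines the toroidal compactification $\overline{\mathcal A}_g^{\mathrm{cent}}$, the normalization of the Igusa blowup) is the dual fan of $Q$: its cones are $\sigma_F=\{B \text{ symmetric}: \operatorname{tr}(AB)\le \operatorname{tr}(A'B)\ \forall A\in F,\ A'\in Q\}$ for $F$ a non-empty face of $Q$. For a graph $G$ of genus $g$, $H^1(G,\mathbb Z)$ is free of rank $g$; choosing a basis, let $S(G)$ be the set of the non-zero symmetric matrices $(e^*)^2=e^*\otimes e^*$, $e\in E$. Let $G_0$ be the graph with vertices $n_1,\dots,n_5,n_7,\dots,n_{11},v_1,v_2,v_3$ and the $21$ edges $n_1n_2$, $n_2n_3$, $n_3n_4$, $n_4n_1$, $n_1n_5$, $n_5n_3$; $n_7n_8$, $n_8n_9$, $n_9n_{10}$, $n_{10}n_7$, $n_7n_{11}$, $n_{11}n_9$; $n_2v_1$, $v_1n_8$, $n_5v_2$, $v_2n_{11}$, $n_4v_3$, $v_3n_{10}$; $v_1v_2$,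 $v_2v_3$, $v_3v_1$. Then: 1. $G_0$ is a stable graph of genus $9$ which does not admit a $\mathbb Z$-emm. 2. For every $g\ge 9$ there exists a stable graph $G$ of genus $g$ which does not admit a $\mathbb Z$-emm. 3. Moreover, for $G_0$ (with $g=9$), and for a graph $G$ as in 2 for every $g\ge9$, in every basis of $H^1(G,\mathbb Z)$ the set $S(G)$ is not contained in any cone of the central cones fan $\tau^{\mathrm{cent}}$. -/

import Mathlib

open scoped Matrix

/-- A graph with vertex set `V` and edge set `E`, multiple edges and loops allowed, together with
an orientation of its edges: the edge `e` goes from `G.beg e` to `G.fin e`. -/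
structure OrGraph (V E : Type) where
  beg : E → V
  fin : E → V

namespace OrGraph

section Basic

variable {V E : Type} (G : OrGraph V E)

/-- The boundary map `C_1(G, ℤ) → C_0(G, ℤ)`, `e ↦ end(e) - beg(e)`. -/
noncomputable def boundary : (E →₀ ℤ) →ₗ[ℤ] (V →₀ ℤ) :=
  Finsupp.linearCombination ℤ fun e => Finsupp.single (G.fin e) 1 - Finsupp.single (G.beg e) 1

/-- The group of cycles `H_1(G, ℤ)`. -/
noncomputable abbrev homology : Submodule ℤ (E →₀ ℤ) := LinearMap.ker G.boundary

/-- The genus of `G`: the rank of `H_1(G, ℤ)`. -/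
noncomputable def genus : ℕ := Module.finrank ℤ G.homology

/-- The coboundary map `C^0(G, ℤ) → C^1(G, ℤ)`, `(d f)(e) = f(end(e)) - f(beg(e))`, so that
`d v^*` is the sum of `e^*` over edges `e` ending in `v` minus the sum of `e^*` over edges
beginning in `v`. -/
def coboundary : (V → ℤ) →ₗ[ℤ] (E → ℤ) where
  toFun f e := f (G.fin e) - f (G.beg e)
  map_add' f f' := by funext e; simp only [Pi.add_apply]; ring
  map_smul' a f := by funext e; simp only [Pi.smul_apply, smul_eq_mul, RingHom.id_apply]; ring

/-- The cohomology group `H^1(G, ℤ)`, the cokernel of the coboundary map. -/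
abbrev Cohomology : Type := (E → ℤ) ⧸ LinearMap.range G.coboundary

/-- The class `e^*` of an edge `e` in `H^1(G, ℤ)`. -/
def coedge [DecidableEq E] (e : E) : G.Cohomology :=
  Submodule.Quotient.mk (Pi.single e (1 : ℤ))

/-- `u` and `v` are joined by a path (regardless of orientation) with all edges in `S`. -/
def Joined (S : Set E) (u v : V) : Prop :=
  Relation.EqvGen (fun a b => ∃ e ∈ S, G.beg e = a ∧ G.fin e = b) u v

/-- The graph is non-empty and any two vertices are joined by a path. -/
def Connected : Prop := Nonempty V ∧ ∀ u v : V, G.Joined Set.univ u v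

/-- An edge is a bridge if its ends are not joined by any path that avoids it. -/
def IsBridge (e : E) : Prop := ¬ G.Joined {e' | e' ≠ e} (G.beg e) (G.fin e)

/-- The valence of a vertex; a loop counts twice. -/
def valence [Fintype E] [DecidableEq V] (v : V) : ℕ :=
  (Finset.univ.filter fun e => G.beg e = v).card + (Finset.univ.filter fun e => G.fin e = v).card

/-- A connected graph all of whose vertices have valence at least three: the dual graph of a
stable curve with rational components. -/
def IsStable [Fintype E] [DecidableEq V] : Prop := G.Connected ∧ ∀ v, 3 ≤ G.valence v

/-- Sanity check: the class of an edge in `H^1(G, ℤ)` vanishes exactly for bridges. -/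
theorem coedge_eq_zero_iff [DecidableEq E] (e : E) : G.coedge e = 0 ↔ G.IsBridge e := by
  unfold coedge IsBridge
  rw [Submodule.Quotient.mk_eq_zero, LinearMap.mem_range]
  constructor
  · rintro ⟨f, hf⟩ hj
    have key : ∀ u v, G.Joined {e' | e' ≠ e} u v → f u = f v := by
      intro u v h
      unfold Joined at h
      induction h with
      | rel a b h =>
        obtain ⟨e', he', rfl, rfl⟩ := h
        have h1 := congrFun hf e'
        simp only [coboundary, LinearMap.coe_mk, AddHom.coe_mk] at h1
        rw [Pi.single_eq_of_ne he'] at h1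
        omega
      | refl => rfl
      | symm _ _ _ ih => exact ih.symm
      | trans _ _ _ _ _ ih1 ih2 => exact ih1.trans ih2
    have h1 := congrFun hf e
    simp only [coboundary, LinearMap.coe_mk, AddHom.coe_mk] at h1
    rw [Pi.single_eq_same, key _ _ hj] at h1
    omega
  · intro hb
    classical
    refine ⟨fun v => if G.Joined {e' | e' ≠ e} (G.beg e) v then 0 else 1, ?_⟩
    funext e'
    simp only [coboundary, LinearMap.coe_mk, AddHom.coe_mk]
    by_cases h : e' = e
    · subst h
      have hrefl : G.Joined {e'' | e'' ≠ e'} (G.beg e') (G.beg e') := Relation.EqvGen.refl _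
      rw [if_neg hb, if_pos hrefl, Pi.single_eq_same]
      rfl
    · have hr : G.Joined {e' | e' ≠ e} (G.beg e') (G.fin e') :=
        Relation.EqvGen.rel _ _ ⟨e', h, rfl, rfl⟩
      have hiff : G.Joined {e' | e' ≠ e} (G.beg e) (G.fin e') ↔
          G.Joined {e' | e' ≠ e} (G.beg e) (G.beg e') :=
        ⟨fun h' => Relation.EqvGen.trans _ _ _ h' (Relation.EqvGen.symm _ _ hr),
          fun h' => Relation.EqvGen.trans _ _ _ h' hr⟩
      rw [Pi.single_eq_of_ne h]
      simp only [hiff, sub_self]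

/-- A `ℤ`-edge-minimizing metric: an element `q` of `Sym^2 H_1(G, ℤ)`, that is, an integral
quadratic form on `H^1(G, ℤ)`, which is positive definite, takes the value `1` at `e^*` for every
edge `e` that is not a bridge, and is at least `1` at every non-zero element of `H^1(G, ℤ)`.
(An integral form that is positive at all non-zero lattice vectors is positive definite over the
reals.) -/
structure IsZEmm [DecidableEq E] (q : QuadraticForm ℤ G.Cohomology) : Prop where
  posDef : q.PosDef
  coedge_eq_one : ∀ e, ¬ G.IsBridge e → q (G.coedge e) = 1
  one_le : ∀ v, v ≠ 0 → 1 ≤ q v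

/-- `G` admits a `ℤ`-edge-minimizing metric. -/
def HasZEmm [DecidableEq E] : Prop := ∃ q : QuadraticForm ℤ G.Cohomology, G.IsZEmm q

end Basic

/-- The set `S(G)` of the non-zero tensors `e^* ⊗ e^*`, written as symmetric matrices in a basis of
`H^1(G, ℤ)`. -/
def coedgeSquares {V E : Type} [DecidableEq E] (G : OrGraph V E) {g : ℕ}
    (b : Module.Basis (Fin g) ℤ G.Cohomology) : Set (Matrix (Fin g) (Fin g) ℝ) :=
  {B | ∃ e : E, G.coedge e ≠ 0 ∧
    B = Matrix.of fun i j => (b.repr (G.coedge e) i : ℝ) * (b.repr (G.coedge e) j : ℝ)}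

/-- The explicit graph with 13 vertices and 21 edges. It consists of two copies of `K_{2,3}`, with
parts `{0, 2}`, `{1, 3, 4}` and `{5, 7}`, `{6, 8, 9}`, of paths `1 - 10 - 6`, `4 - 11 - 9`,
`3 - 12 - 8` and of the triangle on `10, 11, 12`. -/
def figureGraph : OrGraph (Fin 13) (Fin 21) where
  beg := ![0, 1, 2, 3, 5, 6, 7, 8, 0, 4, 5, 9, 1, 10, 4, 11, 3, 12, 10, 11, 12]
  fin := ![1, 2, 3, 0, 6, 7, 8, 5, 4, 2, 9, 7, 10, 6, 11, 9, 12, 8, 11, 12, 10]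

end OrGraph

/-- The positive definite elements of the lattice `M` of half-integral symmetric matrices
(integral on the diagonal), that is, the positive definite integral quadratic forms. -/
def integralPosDef (g : ℕ) : Set (Matrix (Fin g) (Fin g) ℝ) :=
  {A | A.PosDef ∧ A ≠ 0 ∧ (∀ i, ∃ k : ℤ, A i i = k) ∧ ∀ i j, ∃ k : ℤ, 2 * A i j = k}

/-- The convex hull of the non-zero positive definite integral quadratic forms. -/
def centralPolyhedron (g : ℕ) : Set (Matrix (Fin g) (Fin g) ℝ) :=
  convexHull ℝ (integralPosDef g)

/-- The cone dual to a face `F` of the polyhedron: all symmetric matrices `B` for which the linear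
function `trace (A B)` of `A` attains its minimum over the polyhedron at every point of `F`. -/
def dualCone (g : ℕ) (F : Set (Matrix (Fin g) (Fin g) ℝ)) : Set (Matrix (Fin g) (Fin g) ℝ) :=
  {B | B.IsSymm ∧ ∀ A ∈ F, ∀ A' ∈ centralPolyhedron g, (A * B).trace ≤ (A' * B).trace}

/-- The central cones fan: the dual fan of the polyhedron, whose cones are the dual cones of its
non-empty faces. -/
def centralFan (g : ℕ) : Set (Set (Matrix (Fin g) (Fin g) ℝ)) :=
  {σ | ∃ F, F.Nonempty ∧ IsExposed ℝ (centralPolyhedron g) F ∧ σ = dualCone g F}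

/-! Let `q` be a `ℤ`-emm on the graph `figureGraph` and `B` its polar form. Then `B x x ≥ 2` for
every nonzero class, and every edge class is a root, that is, has norm 2. Around one copy of
`K_{2,3}` let `x i` and `y i` be the signed edge classes at its two trivalent vertices. The vertex
relations say that the `x i` sum to zero, that the `y i` sum to zero, and that `x i + y i` is, up to
sign, the edge leaving the copy. These roots determine the Gram matrix up to exchanging `x` and `y`,
and generate a lattice of type `D₄`: it contains four orthogonal roots together with their half sum
(`exists_frame`).

The two copies give independent lattices `L` and `L'`. Either their frames are orthogonal, or the
matrix of inner products is, up to permutations and signs, one of two explicit matrices, and for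
both the Gram matrix of `L + L'` is unimodular (type `E₈`). A unimodular sublattice splits off
orthogonally, so a root outside it must be orthogonal to it. In the orthogonal case, a root outside
the span cannot meet both frames, because its projection would be too long. This is `not_connected`.

The triangle edge `t` and `t - (p + p')` are both roots, where `p` and `p'` are classes leaving the
two copies. Hence `B t p + B t p' = 2 + B p p'`, which forces exactly the meetings just excluded
(`not_two_copies`).

Attaching loops raises the genus: restricting a `ℤ`-emm to the cohomology of the smaller graph gives
a `ℤ`-emm there. For the fan, a point of the face `F` is a convex combination of positive definite
integral forms. Edge classes are primitive, so some form takes the value 1 at each of them. If all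
edge tensors lie in the cone of `F`, each form of positive weight must then have the value 1 at
every edge class, so it is a `ℤ`-emm (`hasZEmm_of_subset_cone`). -/

namespace RootForm

/-! ### Frames of type `D₄` and projections to unimodular lattices -/

variable {H : Type*} [AddCommGroup H]

/-- Projection to the span of a family whose Gram matrix is invertible over `ℤ`. -/
theorem exists_projection (B : H →ₗ[ℤ] H →ₗ[ℤ] ℤ) {n : ℕ} (l : Fin n → H)
    (G I : Matrix (Fin n) (Fin n) ℤ) (hG : ∀ i j, B (l i) (l j) = G i j) (hI : I * G = 1) (t : H) :
    ∃ w ∈ Submodule.span ℤ (Set.range l),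
      ∀ u ∈ Submodule.span ℤ (Set.range l), B (t - w) u = 0 := by
  -- The coefficients solve the normal equations `B w (l j) = B t (l j)`; they are integers because
  -- the inverse `I` is.
  refine ⟨∑ k, (∑ m, B t (l m) * I m k) • l k,
    Submodule.sum_mem _ fun k _ => Submodule.smul_mem _ _ (Submodule.subset_span ⟨k, rfl⟩), ?_⟩
  intro u hu
  have hle : Submodule.span ℤ (Set.range l) ≤
      LinearMap.ker (B (t - ∑ k, (∑ m, B t (l m) * I m k) • l k)) := by
    rw [Submodule.span_le]
    rintro _ ⟨j, rfl⟩
    simp only [SetLike.mem_coe, LinearMap.mem_ker, map_sub, map_sum, map_smul, LinearMap.sub_apply,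
      LinearMap.sum_apply, LinearMap.smul_apply, hG, smul_eq_mul, Finset.sum_mul]
    rw [Finset.sum_comm]
    have hm : ∀ m, ∑ k, B t (l m) * I m k * G k j = B t (l m) * (1 : Matrix (Fin n) (Fin n) ℤ) m j := by
      intro m
      rw [← hI, Matrix.mul_apply, Finset.mul_sum]
      exact Finset.sum_congr rfl fun k _ => mul_assoc _ _ _
    simp [hm, Matrix.one_apply]
  exact hle hu

/-- An orthogonal frame of four roots in `L` whose half sum lies in `L`; it generates a root
lattice of type `D₄`. -/
structure IsFrame (B : H →ₗ[ℤ] H →ₗ[ℤ] ℤ) (L : Submodule ℤ H) (f : Fin 4 → H) : Prop where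
  norm : ∀ i, B (f i) (f i) = 2
  orth : ∀ i j, i ≠ j → B (f i) (f j) = 0
  mem : ∀ i, f i ∈ L
  half : ∃ h ∈ L, h + h = f 0 + f 1 + f 2 + f 3

/-- A symmetric form of minimum at least two together with two independent submodules. -/
structure IsPair (B : H →ₗ[ℤ] H →ₗ[ℤ] ℤ) (L L' : Submodule ℤ H) : Prop where
  symm : ∀ x y, B x y = B y x
  pos : ∀ x, x ≠ 0 → 2 ≤ B x x
  disj : Disjoint L L'

/-- The orthogonal projection of `t` to the span of two frames is integral. -/
def HasProjection (B : H →ₗ[ℤ] H →ₗ[ℤ] ℤ) (L L' : Submodule ℤ H) (t : H) (f f' : Fin 4 → H) :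
    Prop :=
  ∃ w ∈ L ⊔ L', B (t - w) w = 0 ∧ (∀ i, B (t - w) (f i) = 0) ∧ ∀ i, B (t - w) (f' i) = 0

variable {B : H →ₗ[ℤ] H →ₗ[ℤ] ℤ} {L L' : Submodule ℤ H} {t : H} {f f' : Fin 4 → H}

theorem IsPair.swap (hP : IsPair B L L') : IsPair B L' L := ⟨hP.symm, hP.pos, hP.disj.symm⟩

theorem IsFrame.perm (hf : IsFrame B L f) (σ : Equiv.Perm (Fin 4)) :
    IsFrame B L fun i => f (σ i) := by
  refine ⟨fun i => hf.norm _, fun i j hij => hf.orth _ _ (σ.injective.ne hij),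
    fun i => hf.mem _, ?_⟩
  obtain ⟨h, hh, e⟩ := hf.half
  refine ⟨h, hh, ?_⟩
  have h1 := Equiv.sum_comp σ f
  simp only [Fin.sum_univ_four] at h1
  rw [e, h1]

theorem HasProjection.of_perm (σ τ : Equiv.Perm (Fin 4))
    (h : HasProjection B L L' t (fun i => f (σ i)) fun i => f' (τ i)) :
    HasProjection B L L' t f f' := by
  obtain ⟨w, hw, h1, h2, h3⟩ := h
  refine ⟨w, hw, h1, fun i => ?_, fun i => ?_⟩
  · simpa using h2 (σ.symm i)
  · simpa using h3 (τ.symm i)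

/-- Reversing `f i` changes the half sum by `f i`, which lies in `L`. -/
theorem IsFrame.flip (hf : IsFrame B L f) {ε : Fin 4 → ℤ} (hε : ∀ i, ε i = 1 ∨ ε i = -1) :
    IsFrame B L fun i => ε i • f i := by
  refine ⟨fun i => ?_, fun i j hij => ?_, fun i => L.smul_mem _ (hf.mem i), ?_⟩
  · rcases hε i with h | h <;> simp [h, hf.norm]
  · simp [hf.orth i j hij]
  · obtain ⟨h, hh, e⟩ := hf.half
    have hc : ∀ i, ∃ c : ℤ, ε i = 1 - 2 * c := fun i => by
      rcases hε i with h | h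
      · exact ⟨0, by omega⟩
      · exact ⟨1, by omega⟩
    choose c hc using hc
    refine ⟨h - ∑ i, c i • f i,
      L.sub_mem hh (L.sum_mem fun i _ => L.smul_mem _ (hf.mem i)), ?_⟩
    have e2 : h - ∑ i, c i • f i + (h - ∑ i, c i • f i) = (h + h) - ∑ i, (2 * c i) • f i := by
      simp only [mul_smul, ← Finset.smul_sum]
      module
    rw [e2, e, Fin.sum_univ_four, hc, hc, hc, hc]
    module

theorem HasProjection.of_flip {ε ε' : Fin 4 → ℤ} (hε : ∀ i, ε i = 1 ∨ ε i = -1)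
    (hε' : ∀ i, ε' i = 1 ∨ ε' i = -1)
    (h : HasProjection B L L' t (fun i => ε i • f i) fun i => ε' i • f' i) :
    HasProjection B L L' t f f' := by
  obtain ⟨w, hw, h1, h2, h3⟩ := h
  refine ⟨w, hw, h1, fun i => ?_, fun i => ?_⟩
  · have := h2 i
    rcases hε i with h | h <;>
      simpa only [h, one_smul, neg_smul, map_neg, neg_eq_zero] using this
  · have := h3 i
    rcases hε' i with h | h <;>
      simpa only [h, one_smul, neg_smul, map_neg, neg_eq_zero] using this

/-- Independence makes `x + y` and `x - y` nonzero, so `4 ± 2 B x y ≥ 2`. -/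
theorem IsPair.cross_le (hP : IsPair B L L') {x y : H} (hx : x ∈ L) (hy : y ∈ L')
    (hxx : B x x = 2) (hyy : B y y = 2) : -1 ≤ B x y ∧ B x y ≤ 1 := by
  have hs := hP.symm x y
  constructor
  · have hne : x + y ≠ 0 := fun h0 => by
      have h1 : x ∈ L' := by
        rw [eq_neg_of_add_eq_zero_left h0]
        exact L'.neg_mem hy
      have h2 := Submodule.disjoint_def.1 hP.disj x hx h1
      simp [h2] at hxx
    have h3 := hP.pos _ hne
    simp only [map_add, LinearMap.add_apply] at h3
    omega
  · have hne : x - y ≠ 0 := fun h0 => by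
      have h1 : x ∈ L' := by
        rw [sub_eq_zero.1 h0]
        exact hy
      have h2 := Submodule.disjoint_def.1 hP.disj x hx h1
      simp [h2] at hxx
    have h3 := hP.pos _ hne
    simp only [map_sub, LinearMap.sub_apply] at h3
    omega

/-- The inner products of the half sum of a frame. -/
theorem IsFrame.half_inner (hf : IsFrame B L f) (hs : ∀ x y, B x y = B y x) {h : H}
    (e : h + h = f 0 + f 1 + f 2 + f 3) : (∀ i, B (f i) h = 1) ∧ (∀ i, B h (f i) = 1) ∧ B h h = 2 := by
  have h1 : ∀ i, B (f i) h = 1 := by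
    intro i
    have := congrArg (B (f i)) e
    have hn := hf.norm i
    have ho := hf.orth i
    simp only [map_add] at this
    clear hs
    fin_cases i <;> simp_all <;> omega
  refine ⟨h1, fun i => hs h _ ▸ h1 i, ?_⟩
  have := congrArg (fun v => B v h) e
  simp only [map_add, LinearMap.add_apply, h1] at this
  omega

/-- The number of nonzero entries in a row of the matrix of inner products. -/
theorem IsPair.row (hP : IsPair B L L') (hf : IsFrame B L f) (hf' : IsFrame B L' f') (i : Fin 4) :
    ∃ k : ℤ, B (f i) (f' 0) + B (f i) (f' 1) + B (f i) (f' 2) + B (f i) (f' 3) = 2 * k ∧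
    B (f i) (f' 0) ^ 2 + B (f i) (f' 1) ^ 2 + B (f i) (f' 2) ^ 2 + B (f i) (f' 3) ^ 2 ≤ 3 := by
  obtain ⟨h', hh', e'⟩ := hf'.half
  refine ⟨B (f i) h', ?_, ?_⟩
  · have := congrArg (B (f i)) e'
    simp only [map_add] at this
    omega
  -- `v` is twice the orthogonal projection of `f i` to the span of `f'`. With `S` the sum of the
  -- squares, `2 f i - v` has norm `8 - 2 S`, which must be at least 2.
  · set v : H := B (f i) (f' 0) • f' 0 + B (f i) (f' 1) • f' 1 + B (f i) (f' 2) • f' 2 +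
      B (f i) (f' 3) • f' 3 with hv
    have hvm : v ∈ L' := L'.add_mem (L'.add_mem (L'.add_mem (L'.smul_mem _ (hf'.mem 0))
      (L'.smul_mem _ (hf'.mem 1))) (L'.smul_mem _ (hf'.mem 2))) (L'.smul_mem _ (hf'.mem 3))
    have hne : f i + f i - v ≠ 0 := fun h0 => by
      have h1 : f i + f i ∈ L' := by rw [sub_eq_zero.1 h0]; exact hvm
      have h2 := Submodule.disjoint_def.1 hP.disj _ (L.add_mem (hf.mem i) (hf.mem i)) h1
      have h3 := congrArg (B (f i)) h2
      simp [hf.norm] at h3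
    have h4 := hP.pos _ hne
    have h5 : ∀ j, B (f' j) (f i) = B (f i) (f' j) := fun j => hP.symm _ _
    simp only [hv, map_sub, map_add, map_smul, LinearMap.sub_apply, LinearMap.add_apply,
      LinearMap.smul_apply, smul_eq_mul, hf.norm, hf'.norm, h5, hf'.orth 0 1 (by decide),
      hf'.orth 0 2 (by decide), hf'.orth 0 3 (by decide), hf'.orth 1 0 (by decide),
      hf'.orth 1 2 (by decide), hf'.orth 1 3 (by decide), hf'.orth 2 0 (by decide),
      hf'.orth 2 1 (by decide), hf'.orth 2 3 (by decide), hf'.orth 3 0 (by decide),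
      hf'.orth 3 1 (by decide), hf'.orth 3 2 (by decide)] at h4
    nlinarith

theorem IsPair.column (hP : IsPair B L L') (hf : IsFrame B L f) (hf' : IsFrame B L' f')
    (j : Fin 4) :
    ∃ k : ℤ, B (f 0) (f' j) + B (f 1) (f' j) + B (f 2) (f' j) + B (f 3) (f' j) = 2 * k ∧
    B (f 0) (f' j) ^ 2 + B (f 1) (f' j) ^ 2 + B (f 2) (f' j) ^ 2 + B (f 3) (f' j) ^ 2 ≤ 3 := by
  simpa only [hP.symm (f' j)] using hP.swap.row hf' hf j

/-- The sum of all entries is `B (h + h) (h' + h')` for the half sums `h` and `h'`; these are roots,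
so `cross_le` applies to them. -/
theorem IsPair.total (hP : IsPair B L L') (hf : IsFrame B L f) (hf' : IsFrame B L' f') :
    ∃ k : ℤ, -1 ≤ k ∧ k ≤ 1 ∧
      B (f 0) (f' 0) + B (f 0) (f' 1) + B (f 0) (f' 2) + B (f 0) (f' 3) +
      (B (f 1) (f' 0) + B (f 1) (f' 1) + B (f 1) (f' 2) + B (f 1) (f' 3)) +
      (B (f 2) (f' 0) + B (f 2) (f' 1) + B (f 2) (f' 2) + B (f 2) (f' 3)) +
      (B (f 3) (f' 0) + B (f 3) (f' 1) + B (f 3) (f' 2) + B (f 3) (f' 3)) = 4 * k := by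
  obtain ⟨h, hh, e⟩ := hf.half
  obtain ⟨h', hh', e'⟩ := hf'.half
  have h1 := hP.cross_le hh hh' (hf.half_inner hP.symm e).2.2 (hf'.half_inner hP.symm e').2.2
  refine ⟨B h h', h1.1, h1.2, ?_⟩
  have h2 := congrArg (fun v => B v h') e
  have h3 := fun i => congrArg (B (f i)) e'
  simp only [map_add, LinearMap.add_apply] at h2 h3
  have := h3 0
  have := h3 1
  have := h3 2
  have := h3 3
  omega

/-- If the Gram matrix of the lattice generated by two frames is invertible over `ℤ`, the
projection to this lattice is integral. -/
theorem hasProjection_of_gram (hP : IsPair B L L') (hf : IsFrame B L f) (hf' : IsFrame B L' f')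
    (N : Matrix (Fin 4) (Fin 4) ℤ) (hN : ∀ i j, B (f i) (f' j) = N i j) (r c : Fin 4 → ℤ) (m : ℤ)
    (hr : ∀ i, N i 0 + N i 1 + N i 2 + N i 3 = 2 * r i)
    (hc : ∀ j, N 0 j + N 1 j + N 2 j + N 3 j = 2 * c j)
    (hm : r 0 + r 1 + r 2 + r 3 = 2 * m) (I : Matrix (Fin 8) (Fin 8) ℤ)
    (hI : I * !![2, 0, 0, 1, N 0 0, N 0 1, N 0 2, r 0;
                 0, 2, 0, 1, N 1 0, N 1 1, N 1 2, r 1;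
                 0, 0, 2, 1, N 2 0, N 2 1, N 2 2, r 2;
                 1, 1, 1, 2, c 0, c 1, c 2, m;
                 N 0 0, N 1 0, N 2 0, c 0, 2, 0, 0, 1;
                 N 0 1, N 1 1, N 2 1, c 1, 0, 2, 0, 1;
                 N 0 2, N 1 2, N 2 2, c 2, 0, 0, 2, 1;
                 r 0, r 1, r 2, m, 1, 1, 1, 2] = 1) :
    HasProjection B L L' t f f' := by
  obtain ⟨h, hh, e⟩ := hf.half
  obtain ⟨h', hh', e'⟩ := hf'.half
  obtain ⟨a1, a2, a3⟩ := hf.half_inner hP.symm e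
  obtain ⟨b1, b2, b3⟩ := hf'.half_inner hP.symm e'
  have hN' : ∀ i j, B (f' j) (f i) = N i j := fun i j => hP.symm (f i) _ ▸ hN i j
  have c1 : ∀ i, B (f i) h' = r i := fun i => by
    have := congrArg (B (f i)) e'
    simp only [map_add, hN] at this
    linarith [hr i]
  have c2 : ∀ i, B h' (f i) = r i := fun i => hP.symm (f i) _ ▸ c1 i
  have d2 : ∀ j, B (f' j) h = c j := fun j => by
    have := congrArg (B (f' j)) e
    simp only [map_add, hN'] at this
    linarith [hc j]
  have d1 : ∀ j, B h (f' j) = c j := fun j => hP.symm (f' j) _ ▸ d2 j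
  have m1 : B h h' = m := by
    have := congrArg (fun v => B v h') e
    simp only [map_add, LinearMap.add_apply, c1] at this
    linarith
  have m2 : B h' h = m := hP.symm h _ ▸ m1
  -- In each frame the half sum replaces the last vector, giving a basis of the `D₄` lattice.
  set l : Fin 8 → H := ![f 0, f 1, f 2, h, f' 0, f' 1, f' 2, h'] with hl
  obtain ⟨w, hw, hwu⟩ := exists_projection B l _ I (fun i j => by
    fin_cases i <;> fin_cases j <;>
      simp [hl, hf.norm, hf'.norm, hf.orth, hf'.orth, a1, a2, a3, b1, b2, b3, hN, hN', c1, c2, d1,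
        d2, m1, m2]) hI t
  have hmem : ∀ k, l k ∈ Submodule.span ℤ (Set.range l) := fun k => Submodule.subset_span ⟨k, rfl⟩
  have g3 : f 3 = l 3 + l 3 - l 0 - l 1 - l 2 := by
    change f 3 = h + h - f 0 - f 1 - f 2
    rw [e]; abel
  have g3' : f' 3 = l 7 + l 7 - l 4 - l 5 - l 6 := by
    change f' 3 = h' + h' - f' 0 - f' 1 - f' 2
    rw [e']; abel
  refine ⟨w, ?_, hwu w hw, fun i => ?_, fun i => ?_⟩
  · refine (Submodule.span_le.2 ?_) hw
    rintro _ ⟨k, rfl⟩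
    have i1 : ∀ i, f i ∈ L ⊔ L' := fun i => Submodule.mem_sup_left (hf.mem i)
    have i2 : ∀ i, f' i ∈ L ⊔ L' := fun i => Submodule.mem_sup_right (hf'.mem i)
    have i3 : h ∈ L ⊔ L' := Submodule.mem_sup_left hh
    have i4 : h' ∈ L ⊔ L' := Submodule.mem_sup_right hh'
    fin_cases k <;> simp [hl, i1, i2, i3, i4]
  · apply hwu
    fin_cases i
    · exact hmem 0
    · exact hmem 1
    · exact hmem 2
    · change f 3 ∈ _
      rw [g3]
      exact sub_mem (sub_mem (sub_mem (add_mem (hmem 3) (hmem 3)) (hmem 0)) (hmem 1)) (hmem 2)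
  · apply hwu
    fin_cases i
    · exact hmem 4
    · exact hmem 5
    · exact hmem 6
    · change f' 3 ∈ _
      rw [g3']
      exact sub_mem (sub_mem (sub_mem (add_mem (hmem 7) (hmem 7)) (hmem 4)) (hmem 5)) (hmem 6)

end RootForm

/-! ### Classification of the inner products of two frames -/

namespace RootForm

variable {H : Type*} [AddCommGroup H] {B : H →ₗ[ℤ] H →ₗ[ℤ] ℤ} {L L' : Submodule ℤ H} {t : H}
  {f f' : Fin 4 → H}

/-- The sum of squares has the parity of the sum, so being even and at most 3 it is 0 or 2. Absolute
values keep the later case distinctions linear. -/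
theorem natAbs_of_sq_sum_le {a b c d : ℤ}
    (h : ∃ k : ℤ, a + b + c + d = 2 * k ∧ a ^ 2 + b ^ 2 + c ^ 2 + d ^ 2 ≤ 3) :
    (a.natAbs + b.natAbs + c.natAbs + d.natAbs = 0 ∨
      a.natAbs + b.natAbs + c.natAbs + d.natAbs = 2) ∧
    a.natAbs ≤ 1 ∧ b.natAbs ≤ 1 ∧ c.natAbs ≤ 1 ∧ d.natAbs ≤ 1 := by
  obtain ⟨k, h1, h2⟩ := h
  have bound : ∀ x : ℤ, x ^ 2 ≤ 3 → -1 ≤ x ∧ x ≤ 1 := fun x hx => by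
    constructor <;> nlinarith
  obtain ⟨a1, a2⟩ := bound a (by nlinarith [sq_nonneg b, sq_nonneg c, sq_nonneg d])
  obtain ⟨b1, b2⟩ := bound b (by nlinarith [sq_nonneg a, sq_nonneg c, sq_nonneg d])
  obtain ⟨c1, c2⟩ := bound c (by nlinarith [sq_nonneg b, sq_nonneg a, sq_nonneg d])
  obtain ⟨d1, d2⟩ := bound d (by nlinarith [sq_nonneg b, sq_nonneg c, sq_nonneg a])
  interval_cases a <;> interval_cases b <;> interval_cases c <;> interval_cases d <;>
    first | (exfalso; norm_num at h2; done) | (exfalso; omega) | decide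

theorem unit_of_natAbs {a : ℤ} (h : a ≠ 0) (h1 : a.natAbs ≤ 1) : a = 1 ∨ a = -1 := by omega

/-- The matrix of inner products of two frames: every row and column has either no or two nonzero
entries, equal to `±1`. -/
theorem IsPair.rows (hP : IsPair B L L') (hf : IsFrame B L f) (hf' : IsFrame B L' f') (i : Fin 4) :
    ((B (f i) (f' 0)).natAbs + (B (f i) (f' 1)).natAbs + (B (f i) (f' 2)).natAbs +
      (B (f i) (f' 3)).natAbs = 0 ∨
    (B (f i) (f' 0)).natAbs + (B (f i) (f' 1)).natAbs + (B (f i) (f' 2)).natAbs +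
      (B (f i) (f' 3)).natAbs = 2) ∧ (B (f i) (f' 0)).natAbs ≤ 1 ∧ (B (f i) (f' 1)).natAbs ≤ 1 ∧
      (B (f i) (f' 2)).natAbs ≤ 1 ∧ (B (f i) (f' 3)).natAbs ≤ 1 :=
  natAbs_of_sq_sum_le (hP.row hf hf' i)

theorem IsPair.columns (hP : IsPair B L L') (hf : IsFrame B L f) (hf' : IsFrame B L' f')
    (j : Fin 4) :
    ((B (f 0) (f' j)).natAbs + (B (f 1) (f' j)).natAbs + (B (f 2) (f' j)).natAbs +
      (B (f 3) (f' j)).natAbs = 0 ∨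
    (B (f 0) (f' j)).natAbs + (B (f 1) (f' j)).natAbs + (B (f 2) (f' j)).natAbs +
      (B (f 3) (f' j)).natAbs = 2) ∧ (B (f 0) (f' j)).natAbs ≤ 1 ∧ (B (f 1) (f' j)).natAbs ≤ 1 ∧
      (B (f 2) (f' j)).natAbs ≤ 1 ∧ (B (f 3) (f' j)).natAbs ≤ 1 :=
  natAbs_of_sq_sum_le (hP.column hf hf' j)

theorem sign_vec {a b c d : ℤ} (ha : a = 1 ∨ a = -1) (hb : b = 1 ∨ b = -1) (hc : c = 1 ∨ c = -1)
    (hd : d = 1 ∨ d = -1) (i : Fin 4) : ![a, b, c, d] i = 1 ∨ ![a, b, c, d] i = -1 := by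
  fin_cases i
  exacts [ha, hb, hc, hd]

theorem IsPair.natAbs_le (hP : IsPair B L L') (hf : IsFrame B L f) (hf' : IsFrame B L' f')
    (i j : Fin 4) : (B (f i) (f' j)).natAbs ≤ 1 := by
  have := hP.cross_le (hf.mem i) (hf'.mem j) (hf.norm i) (hf'.norm j)
  omega

/-- The prescribed entries extend to a cycle of six or eight nonzero entries. For eight, signs can
be chosen so that seven entries are 1; the total is then 6 or 8, contradicting `IsPair.total`. For
six, the total is 4 or 6, so the last entry is `-1` and the Gram matrix is known. -/
theorem hasProjection_hexagon (hP : IsPair B L L') (hf : IsFrame B L f) (hf' : IsFrame B L' f')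
    (h00 : B (f 0) (f' 0) = 1) (h01 : B (f 0) (f' 1) = 1) (h10 : B (f 1) (f' 0) = 1)
    (h12 : B (f 1) (f' 2) = 1) (h21 : B (f 2) (f' 1) = 1) : HasProjection B L L' t f f' := by
  have ⟨z02, z03⟩ : B (f 0) (f' 2) = 0 ∧ B (f 0) (f' 3) = 0 := by
    have := hP.rows hf hf' 0
    omega
  have ⟨z20, z30⟩ : B (f 2) (f' 0) = 0 ∧ B (f 3) (f' 0) = 0 := by
    have := hP.columns hf hf' 0
    omega
  have ⟨z11, z13⟩ : B (f 1) (f' 1) = 0 ∧ B (f 1) (f' 3) = 0 := by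
    have := hP.rows hf hf' 1
    omega
  have z31 : B (f 3) (f' 1) = 0 := by
    have := hP.columns hf hf' 1
    omega
  by_cases h22 : B (f 2) (f' 2) = 0
  · exfalso
    have u23 : B (f 2) (f' 3) = 1 ∨ B (f 2) (f' 3) = -1 := by
      have := hP.rows hf hf' 2
      omega
    have u32 : B (f 3) (f' 2) = 1 ∨ B (f 3) (f' 2) = -1 := by
      have := hP.columns hf hf' 2
      omega
    have u33 : B (f 3) (f' 3) = 1 ∨ B (f 3) (f' 3) = -1 := by
      have := hP.rows hf hf' 3
      omega
    obtain ⟨k, k1, k2, hk⟩ := hP.total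
      (hf.flip (sign_vec (Or.inl rfl) (Or.inl rfl) (Or.inl rfl) u32))
      (hf'.flip (sign_vec (Or.inl rfl) (Or.inl rfl) (Or.inl rfl) u23))
    rcases u23 with u23 | u23 <;> rcases u32 with u32 | u32 <;> rcases u33 with u33 | u33 <;>
      simp [h00, h01, h10, h12, h21, h22, z02, z03, z20, z30, z11, z13, z31, u23, u32, u33] at hk <;>
      omega
  · have ⟨z23, u22⟩ : B (f 2) (f' 3) = 0 ∧ (B (f 2) (f' 2) = 1 ∨ B (f 2) (f' 2) = -1) := by
      have := hP.rows hf hf' 2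
      omega
    have z32 : B (f 3) (f' 2) = 0 := by
      have := hP.columns hf hf' 2
      omega
    have z33 : B (f 3) (f' 3) = 0 := by
      have := hP.rows hf hf' 3
      omega
    obtain ⟨k, k1, k2, hk⟩ := hP.total hf hf'
    have h22' : B (f 2) (f' 2) = -1 := by omega
    -- The `8 × 8` literal is the inverse of the resulting Gram matrix.
    refine hasProjection_of_gram hP hf hf'
      !![1, 1, 0, 0; 1, 0, 1, 0; 0, 1, -1, 0; 0, 0, 0, 0] (fun i j => ?_)
      ![1, 1, 0, 0] ![1, 1, 0, 0] 1 (by decide) (by decide) (by decide)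
      !![2, 1, 1, -1, -1, -1, 0, 0;
         1, 2, 0, -1, -1, 0, -1, 0;
         1, 0, 2, -1, 0, -1, 1, 0;
         -1, -1, -1, 2, 0, 0, 0, 0;
         -1, -1, 0, 0, 2, 1, 1, -1;
         -1, 0, -1, 0, 1, 2, 0, -1;
         0, -1, 1, 0, 1, 0, 2, -1;
         0, 0, 0, 0, -1, -1, -1, 2] (by decide)
    fin_cases i <;> fin_cases j <;>
      simp [h00, h01, h10, h12, h21, h22', z02, z03, z20, z30, z11, z13, z31, z23, z32, z33]

/-- The nonzero entries form two `2 × 2` blocks. The total is 4 or 6, so `IsPair.total` forces the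
last sign and the Gram matrix is again unimodular. -/
theorem hasProjection_blocks (hP : IsPair B L L') (hf : IsFrame B L f) (hf' : IsFrame B L' f')
    (h00 : B (f 0) (f' 0) = 1) (h01 : B (f 0) (f' 1) = 1) (h10 : B (f 1) (f' 0) = 1)
    (h11 : B (f 1) (f' 1) = -1) (h22 : B (f 2) (f' 2) = 1) (h23 : B (f 2) (f' 3) = 1)
    (h32 : B (f 3) (f' 2) = 1) : HasProjection B L L' t f f' := by
  have ⟨z02, z03⟩ : B (f 0) (f' 2) = 0 ∧ B (f 0) (f' 3) = 0 := by
    have := hP.rows hf hf' 0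
    omega
  have ⟨z20, z30⟩ : B (f 2) (f' 0) = 0 ∧ B (f 3) (f' 0) = 0 := by
    have := hP.columns hf hf' 0
    omega
  have ⟨z12, z13⟩ : B (f 1) (f' 2) = 0 ∧ B (f 1) (f' 3) = 0 := by
    have := hP.rows hf hf' 1
    omega
  have ⟨z21, z31⟩ : B (f 2) (f' 1) = 0 ∧ B (f 3) (f' 1) = 0 := by
    have := hP.columns hf hf' 1
    omega
  have u33 : B (f 3) (f' 3) = 1 ∨ B (f 3) (f' 3) = -1 := by
    have := hP.rows hf hf' 3
    omega
  obtain ⟨k, k1, k2, hk⟩ := hP.total hf hf'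
  have h33 : B (f 3) (f' 3) = -1 := by omega
  refine hasProjection_of_gram hP hf hf'
    !![1, 1, 0, 0; 1, -1, 0, 0; 0, 0, 1, 1; 0, 0, 1, -1] (fun i j => ?_)
    ![1, 0, 1, 0] ![1, 0, 1, 0] 1 (by decide) (by decide) (by decide)
    !![2, 1, 1, -2, 0, 0, 1, -1;
       1, 2, 1, -2, 0, 1, 1, -1;
       1, 1, 2, -2, 1, 1, 1, -2;
       -2, -2, -2, 4, -1, -1, -2, 2;
       0, 0, 1, -1, 2, 1, 1, -2;
       0, 1, 1, -1, 1, 2, 1, -2;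
       1, 1, 1, -2, 1, 1, 2, -2;
       -1, -1, -2, 2, -2, -2, -2, 4] (by decide)
  fin_cases i <;> fin_cases j <;>
    simp [h00, h01, h10, h11, h22, h23, h32, h33, z02, z03, z20, z30, z12, z13, z21, z31]

/-- Otherwise `f 0 + f 1 - (f' 0 + f' 1)` would have norm `4 + 4 - 8 = 0`, against independence. -/
theorem IsPair.not_block (hP : IsPair B L L') (hf : IsFrame B L f) (hf' : IsFrame B L' f')
    (h00 : B (f 0) (f' 0) = 1) (h01 : B (f 0) (f' 1) = 1) (h10 : B (f 1) (f' 0) = 1) :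
    B (f 1) (f' 1) ≠ 1 := by
  intro h11
  have hne : f 0 + f 1 - (f' 0 + f' 1) ≠ 0 := fun h0 => by
    have h1 : f 0 + f 1 ∈ L' := by
      rw [sub_eq_zero.1 h0]; exact L'.add_mem (hf'.mem 0) (hf'.mem 1)
    have h2 := Submodule.disjoint_def.1 hP.disj _ (L.add_mem (hf.mem 0) (hf.mem 1)) h1
    have h3 := congrArg (B (f 0)) h2
    simp [hf.norm, hf.orth] at h3
  have h4 := hP.pos _ hne
  simp [hf.norm, hf.orth, hf'.norm, hf'.orth, h00, h01, h10, h11, hP.symm (f' _) (f _)] at h4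

/-- The entry at position `(1, 1)` decides the shape: zero leads to the hexagon, nonzero closes a
block. -/
theorem hasProjection_of_three (hP : IsPair B L L') (hf : IsFrame B L f) (hf' : IsFrame B L' f')
    (h00 : B (f 0) (f' 0) = 1) (h01 : B (f 0) (f' 1) = 1) (h10 : B (f 1) (f' 0) = 1) :
    HasProjection B L L' t f f' := by
  have one : (1 : ℤ) = 1 ∨ (1 : ℤ) = -1 := Or.inl rfl
  have hnb := hP.not_block hf hf' h00 h01 h10
  by_cases h11 : B (f 1) (f' 1) = 0
  · obtain ⟨τ, τ0, τ1, hτ⟩ : ∃ τ : Equiv.Perm (Fin 4), τ 0 = 0 ∧ τ 1 = 1 ∧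
        B (f 1) (f' (τ 2)) ≠ 0 := by
      by_cases h : B (f 1) (f' 2) = 0
      · refine ⟨Equiv.swap 2 3, by decide, by decide, ?_⟩
        rw [Equiv.swap_apply_left]
        have := hP.rows hf hf' 1
        omega
      · exact ⟨1, rfl, rfl, h⟩
    obtain ⟨σ, σ0, σ1, hσ⟩ : ∃ σ : Equiv.Perm (Fin 4), σ 0 = 0 ∧ σ 1 = 1 ∧
        B (f (σ 2)) (f' 1) ≠ 0 := by
      by_cases h : B (f 2) (f' 1) = 0
      · refine ⟨Equiv.swap 2 3, by decide, by decide, ?_⟩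
        rw [Equiv.swap_apply_left]
        have := hP.columns hf hf' 1
        omega
      · exact ⟨1, rfl, rfl, h⟩
    have u := unit_of_natAbs hτ (hP.natAbs_le hf hf' _ _)
    have v := unit_of_natAbs hσ (hP.natAbs_le hf hf' _ _)
    refine HasProjection.of_perm σ τ (HasProjection.of_flip (sign_vec one one v one)
      (sign_vec one one u one) (hasProjection_hexagon hP ((hf.perm σ).flip (sign_vec one one v one))
        ((hf'.perm τ).flip (sign_vec one one u one)) ?_ ?_ ?_ ?_ ?_))
    · simp [σ0, τ0, h00]
    · simp [σ0, τ1, h01]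
    · simp [σ1, τ0, h10]
    · rcases u with u | u <;> simp [σ1, u]
    · rcases v with v | v <;> simp [τ1, v]
  · have ⟨m11, z12, z13⟩ : B (f 1) (f' 1) = -1 ∧ B (f 1) (f' 2) = 0 ∧ B (f 1) (f' 3) = 0 := by
      have := hP.rows hf hf' 1
      omega
    have ⟨z02, z03⟩ : B (f 0) (f' 2) = 0 ∧ B (f 0) (f' 3) = 0 := by
      have := hP.rows hf hf' 0
      omega
    have ⟨z20, z30⟩ : B (f 2) (f' 0) = 0 ∧ B (f 3) (f' 0) = 0 := by
      have := hP.columns hf hf' 0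
      omega
    have ⟨z21, z31⟩ : B (f 2) (f' 1) = 0 ∧ B (f 3) (f' 1) = 0 := by
      have := hP.columns hf hf' 1
      omega
    -- With a single block the total would be `1 + 1 + 1 - 1 = 2`, which is not a multiple of 4.
    have n22 : B (f 2) (f' 2) ≠ 0 := fun h22 => by
      obtain ⟨k, k1, k2, hk⟩ := hP.total hf hf'
      have z23 : B (f 2) (f' 3) = 0 := by
        have := hP.rows hf hf' 2
        omega
      have z32 : B (f 3) (f' 2) = 0 := by
        have := hP.columns hf hf' 2
        omega
      have z33 : B (f 3) (f' 3) = 0 := by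
        have := hP.rows hf hf' 3
        omega
      omega
    have u22 := unit_of_natAbs n22 (hP.natAbs_le hf hf' _ _)
    have u23 : B (f 2) (f' 3) = 1 ∨ B (f 2) (f' 3) = -1 := by
      have := hP.rows hf hf' 2
      omega
    have u32 : B (f 3) (f' 2) = 1 ∨ B (f 3) (f' 2) = -1 := by
      have := hP.columns hf hf' 2
      omega
    have uu : B (f 3) (f' 2) * B (f 2) (f' 2) = 1 ∨ B (f 3) (f' 2) * B (f 2) (f' 2) = -1 := by
      rcases u22 with h | h <;> rcases u32 with h' | h' <;> simp [h, h']
    refine HasProjection.of_flip (sign_vec one one one uu)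
      (sign_vec one one u22 u23) (hasProjection_blocks hP (hf.flip (sign_vec one one one uu))
        (hf'.flip (sign_vec one one u22 u23)) ?_ ?_ ?_ ?_ ?_ ?_ ?_)
    · simp [h00]
    · simp [h01]
    · simp [h10]
    · simp [m11]
    · rcases u22 with h | h <;> simp [h]
    · rcases u23 with h | h <;> simp [h]
    · rcases u22 with h | h <;> rcases u32 with h' | h' <;> simp [h, h']

theorem exists_perm_one {a : Fin 4 → ℤ} (h0 : a 0 ≠ 0)
    (h : (a 0).natAbs + (a 1).natAbs + (a 2).natAbs + (a 3).natAbs = 0 ∨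
      (a 0).natAbs + (a 1).natAbs + (a 2).natAbs + (a 3).natAbs = 2) (h1 : (a 0).natAbs ≤ 1) :
    ∃ σ : Equiv.Perm (Fin 4), σ 0 = 0 ∧ a (σ 1) ≠ 0 := by
  by_cases g1 : a 1 = 0
  · by_cases g2 : a 2 = 0
    · exact ⟨Equiv.swap 1 3, by decide, by rw [Equiv.swap_apply_left]; omega⟩
    · exact ⟨Equiv.swap 1 2, by decide, by rwa [Equiv.swap_apply_left]⟩
  · exact ⟨1, rfl, g1⟩

/-- A nonzero corner has exactly one nonzero partner in its row and one in its column. Permutations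
move them next to the corner, and signs turn all three into 1. -/
theorem hasProjection_of_corner (hP : IsPair B L L') (hf : IsFrame B L f)
    (hf' : IsFrame B L' f') (h0 : B (f 0) (f' 0) ≠ 0) : HasProjection B L L' t f f' := by
  have one : (1 : ℤ) = 1 ∨ (1 : ℤ) = -1 := Or.inl rfl
  obtain ⟨σ, σ0, hσ⟩ := exists_perm_one (a := fun k => B (f k) (f' 0)) h0
    (hP.columns hf hf' 0).1 (hP.natAbs_le hf hf' _ _)
  obtain ⟨τ, τ0, hτ⟩ := exists_perm_one (a := fun k => B (f 0) (f' k)) h0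
    (hP.rows hf hf' 0).1 (hP.natAbs_le hf hf' _ _)
  refine HasProjection.of_perm σ τ ?_
  have u0 := unit_of_natAbs h0 (hP.natAbs_le hf hf' _ _)
  have uσ := unit_of_natAbs hσ (hP.natAbs_le hf hf' _ _)
  have uτ := unit_of_natAbs hτ (hP.natAbs_le hf hf' _ _)
  have uu : ∀ a b : ℤ, (a = 1 ∨ a = -1) → (b = 1 ∨ b = -1) → (a * b = 1 ∨ a * b = -1) := by
    rintro a b (h | h) (h' | h') <;> simp [h, h']
  have s1 := sign_vec one (uu _ _ uσ u0) one one
  have s2 := sign_vec u0 uτ one one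
  refine HasProjection.of_flip s1 s2 (hasProjection_of_three hP ((hf.perm σ).flip s1)
    ((hf'.perm τ).flip s2) ?_ ?_ ?_)
  · simp only [σ0, τ0]
    rcases u0 with h | h <;> simp [h]
  · simp only [σ0]
    rcases uτ with h | h <;> simp [h]
  · simp only [τ0]
    rcases u0 with h | h <;> rcases uσ with h' | h' <;> simp [h, h']

theorem hasProjection_of_ne_zero (hP : IsPair B L L') (hf : IsFrame B L f)
    (hf' : IsFrame B L' f') {i j : Fin 4} (hij : B (f i) (f' j) ≠ 0) :
    HasProjection B L L' t f f' := by
  refine HasProjection.of_perm (Equiv.swap 0 i) (Equiv.swap 0 j)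
    (hasProjection_of_corner hP (hf.perm _) (hf'.perm _) ?_)
  simpa only [Equiv.swap_apply_left] using hij

/-- No root outside the span of two frames meets both of them, or meets one of them if the frames
are not orthogonal to each other. -/
theorem not_connected (hP : IsPair B L L') (hf : IsFrame B L f) (hf' : IsFrame B L' f')
    (htt : B t t = 2) (ht : ∀ k : ℤ, k • t ∈ L ⊔ L' → k = 0)
    (hmeet : (∃ i, B t (f i) ≠ 0) ∨ ∃ i, B t (f' i) ≠ 0)
    (horth : (∀ i j, B (f i) (f' j) = 0) → (∃ i, B t (f i) ≠ 0) ∧ ∃ i, B t (f' i) ≠ 0) :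
    False := by
  by_cases h0 : ∀ i j, B (f i) (f' j) = 0
  · obtain ⟨⟨i, hi⟩, j, hj⟩ := horth h0
    -- The half sum makes the sum of the `B t (f i)`, hence of their squares, even; it is positive,
    -- so at least 2.
    have even : ∀ {L : Submodule ℤ H} {f : Fin 4 → H}, IsFrame B L f → ∀ i, B t (f i) ≠ 0 →
        2 ≤ B t (f 0) ^ 2 + B t (f 1) ^ 2 + B t (f 2) ^ 2 + B t (f 3) ^ 2 := by
      intro L f hf i hi
      obtain ⟨h, -, e⟩ := hf.half
      have h1 := congrArg (B t) e
      simp only [map_add] at h1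
      have par : ∀ x : ℤ, ∃ k, x ^ 2 = x + 2 * k ∧ 0 ≤ x ^ 2 ∧ (x ≠ 0 → 1 ≤ x ^ 2) := fun x => by
        obtain ⟨k, hk⟩ := Int.even_mul_pred_self x
        refine ⟨k, by linear_combination hk, sq_nonneg x, fun hx => ?_⟩
        have : 0 < x ^ 2 := by positivity
        omega
      obtain ⟨a, a1, a2, a3⟩ := par (B t (f 0))
      obtain ⟨b, b1, b2, b3⟩ := par (B t (f 1))
      obtain ⟨c, c1, c2, c3⟩ := par (B t (f 2))
      obtain ⟨d, d1, d2, d3⟩ := par (B t (f 3))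
      have : B t (f 0) ≠ 0 ∨ B t (f 1) ≠ 0 ∨ B t (f 2) ≠ 0 ∨ B t (f 3) ≠ 0 := by
        fin_cases i
        exacts [Or.inl hi, Or.inr (Or.inl hi), Or.inr (Or.inr (Or.inl hi)),
          Or.inr (Or.inr (Or.inr hi))]
      omega
    have e1 := even hf i hi
    have e2 := even hf' j hj
    set u : H := ∑ i, B t (f i) • f i with hu
    set u' : H := ∑ i, B t (f' i) • f' i with hu'
    have hum : u ∈ L := L.sum_mem fun i _ => L.smul_mem _ (hf.mem i)
    have hum' : u' ∈ L' := L'.sum_mem fun i _ => L'.smul_mem _ (hf'.mem i)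
    -- `u + u'` is twice the projection of `t`, so this vector has norm `8 - 2 (S + S')` with both
    -- sums of squares at least 2: not positive.
    have hne : (2 : ℤ) • t - (u + u') ≠ 0 := fun h => by
      have := ht 2 (by
        rw [sub_eq_zero.1 h]
        exact Submodule.add_mem_sup hum hum')
      omega
    have h4 := hP.pos _ hne
    have s1 : ∀ i, B (f i) t = B t (f i) := fun i => hP.symm _ _
    have s2 : ∀ i, B (f' i) t = B t (f' i) := fun i => hP.symm _ _
    have s3 : ∀ i j, B (f' j) (f i) = 0 := fun i j => hP.symm (f i) _ ▸ h0 i j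
    simp [hu, hu', Fin.sum_univ_four, htt, hf.norm, hf'.norm, hf.orth, hf'.orth, h0, s1, s2, s3]
      at h4
    nlinarith
  · push Not at h0
    obtain ⟨i, j, hij⟩ := h0
    -- `t` splits orthogonally into `w` and `t - w`, both nonzero, hence each of norm at least 2;
    -- but `t` has norm 2.
    obtain ⟨w, hw, h1, h2, h3⟩ := hasProjection_of_ne_zero (t := t) hP hf hf' hij
    have w0 : w ≠ 0 := by
      rintro rfl
      simp only [sub_zero] at h2 h3
      rcases hmeet with ⟨i, hi⟩ | ⟨i, hi⟩
      · exact hi (h2 i)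
      · exact hi (h3 i)
    have tw : t - w ≠ 0 := fun h => by
      have := ht 1 (by rw [one_smul, sub_eq_zero.1 h]; exact hw)
      omega
    have p1 := hP.pos _ w0
    have p2 := hP.pos _ tw
    have s := hP.symm t w
    simp only [map_sub, LinearMap.sub_apply] at h1 p2
    omega

/-- The classes of the edges of `K_{2,3}` contain a frame. -/
theorem exists_frame (hs : ∀ x y, B x y = B y x) (hpos : ∀ x, x ≠ 0 → 2 ≤ B x x)
    {x₁ x₂ x₃ y₁ y₂ y₃ : H} (hx : x₁ + x₂ + x₃ = 0) (hy : y₁ + y₂ + y₃ = 0)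
    (x1 : B x₁ x₁ = 2) (x2 : B x₂ x₂ = 2) (x3 : B x₃ x₃ = 2)
    (y1 : B y₁ y₁ = 2) (y2 : B y₂ y₂ = 2) (y3 : B y₃ y₃ = 2)
    (p1 : B (x₁ + y₁) (x₁ + y₁) = 2) (p2 : B (x₂ + y₂) (x₂ + y₂) = 2)
    (p3 : B (x₃ + y₃) (x₃ + y₃) = 2) (h12 : x₁ - y₂ ≠ 0) (h13 : x₁ - y₃ ≠ 0)
    (hL : x₁ ∈ L ∧ x₂ ∈ L ∧ y₁ ∈ L ∧ y₂ ∈ L) :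
    ∃ f, IsFrame B L f ∧ (x₁ + y₁) + (x₁ + y₁) = f 0 - f 1 - f 2 + f 3 := by
  -- All inner products are forced except `B x₁ y₂` and `B x₂ y₁`, whose sum is 1. This treats the
  -- values 0 and 1.
  have key : ∀ x₁ x₂ y₁ y₂ : H, B x₁ x₁ = 2 → B x₂ x₂ = 2 → B y₁ y₁ = 2 → B y₂ y₂ = 2 →
      B x₁ x₂ = -1 → B y₁ y₂ = -1 → B x₁ y₁ = -1 → B x₂ y₂ = -1 → B x₁ y₂ = 0 → B x₂ y₁ = 1 →
      (x₁ ∈ L ∧ x₂ ∈ L ∧ y₁ ∈ L ∧ y₂ ∈ L) →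
      ∃ f, IsFrame B L f ∧ (x₁ + y₁) + (x₁ + y₁) = f 0 - f 1 - f 2 + f 3 := by
    intro x₁ x₂ y₁ y₂ a1 a2 b1 b2 a12 b12 c11 c22 c12 c21 ⟨m1, m2, n1, n2⟩
    have a21 := hs x₁ x₂ ▸ a12
    have b21 := hs y₁ y₂ ▸ b12
    have d11 := hs x₁ y₁ ▸ c11
    have d22 := hs x₂ y₂ ▸ c22
    have d12 := hs x₁ y₂ ▸ c12
    have d21 := hs x₂ y₁ ▸ c21
    refine ⟨![x₁, y₂, x₂ - y₁, x₁ + x₂ + y₁ + y₂], ⟨?_, ?_, ?_, ?_⟩, ?_⟩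
    · intro i
      fin_cases i <;> simp [*]
    · intro i j hij
      fin_cases i <;> fin_cases j <;> first | exact absurd rfl hij | simp [*]
    · intro i
      fin_cases i
      exacts [m1, n2, L.sub_mem m2 n1, L.add_mem (L.add_mem (L.add_mem m1 m2) n1) n2]
    · refine ⟨x₁ + x₂ + y₂, L.add_mem (L.add_mem m1 m2) n2, ?_⟩
      simp
      abel
    · simp
      abel
  obtain ⟨m1, m2, n1, n2⟩ := hL
  obtain rfl : x₃ = -(x₁ + x₂) := (neg_eq_of_add_eq_zero_right hx).symm
  obtain rfl : y₃ = -(y₁ + y₂) := (neg_eq_of_add_eq_zero_right hy).symm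
  have q2 := hpos _ h12
  have q3 := hpos _ h13
  simp only [map_add, map_neg, map_sub, LinearMap.add_apply, LinearMap.neg_apply,
    LinearMap.sub_apply] at x3 y3 p1 p2 p3 q2 q3
  have s1 := hs x₁ x₂
  have s2 := hs y₁ y₂
  have s3 := hs x₁ y₁
  have s4 := hs x₁ y₂
  have s5 := hs x₂ y₁
  have s6 := hs x₂ y₂
  -- The upper bound comes from the norm of `x₁ - y₂`, the lower bound from that of `x₁ - y₃`. The
  -- second case is the first with `x` and `y` exchanged.
  rcases (show B x₁ y₂ = 0 ∨ B x₁ y₂ = 1 by omega) with h | h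
  · exact key x₁ x₂ y₁ y₂ x1 x2 y1 y2 (by omega) (by omega) (by omega) (by omega) h (by omega)
      ⟨m1, m2, n1, n2⟩
  · obtain ⟨f, hf, e⟩ := key y₁ y₂ x₁ x₂ y1 y2 x1 x2 (by omega) (by omega) (by omega) (by omega)
      (by omega) (by omega) ⟨n1, n2, m1, m2⟩
    exact ⟨f, hf, by rw [← e]; abel⟩

end RootForm

/-! ### Two independent copies of `K_{2,3}` -/

namespace RootForm

variable {H : Type*} [AddCommGroup H] {B : H →ₗ[ℤ] H →ₗ[ℤ] ℤ}

theorem mem_span_four {x₁ x₂ y₁ y₂ u : H} :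
    u ∈ Submodule.span ℤ {x₁, x₂, y₁, y₂} ↔
      ∃ a b c d : ℤ, u = a • x₁ + b • x₂ + c • y₁ + d • y₂ := by
  simp only [Submodule.mem_span_insert, Submodule.mem_span_singleton]
  constructor
  · rintro ⟨a, _, ⟨b, _, ⟨c, _, ⟨d, rfl⟩, rfl⟩, rfl⟩, rfl⟩
    exact ⟨a, b, c, d, by abel⟩
  · rintro ⟨a, b, c, d, rfl⟩
    exact ⟨a, _, ⟨b, _, ⟨c, _, ⟨d, rfl⟩, rfl⟩, rfl⟩, by abel⟩

/-- Two copies of `K_{2,3}`, independent of each other, and an edge `t` that is independent of both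
cannot be realized by roots if `t - (x₁ + y₁ + x₁' + y₁')` is a root as well. -/
theorem not_two_copies (hs : ∀ x y, B x y = B y x) (hpos : ∀ x, x ≠ 0 → 2 ≤ B x x)
    {x x' y y' : Fin 3 → H} {t : H} (hx : x 0 + x 1 + x 2 = 0) (hy : y 0 + y 1 + y 2 = 0)
    (hx' : x' 0 + x' 1 + x' 2 = 0) (hy' : y' 0 + y' 1 + y' 2 = 0)
    (xn : ∀ i, B (x i) (x i) = 2) (yn : ∀ i, B (y i) (y i) = 2)
    (xn' : ∀ i, B (x' i) (x' i) = 2) (yn' : ∀ i, B (y' i) (y' i) = 2)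
    (pn : ∀ i, B (x i + y i) (x i + y i) = 2) (pn' : ∀ i, B (x' i + y' i) (x' i + y' i) = 2)
    (tn : B t t = 2)
    (sn : B (t - (x 0 + y 0 + (x' 0 + y' 0))) (t - (x 0 + y 0 + (x' 0 + y' 0))) = 2)
    (hind : ∀ a b c d a' b' c' d' k : ℤ, a • x 0 + b • x 1 + c • y 0 + d • y 1 +
      (a' • x' 0 + b' • x' 1 + c' • y' 0 + d' • y' 1) + k • t = 0 →
      (a = 0 ∧ b = 0 ∧ c = 0 ∧ d = 0) ∧ (a' = 0 ∧ b' = 0 ∧ c' = 0 ∧ d' = 0) ∧ k = 0) : False := by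
  set L := Submodule.span ℤ {x 0, x 1, y 0, y 1} with hL
  set L' := Submodule.span ℤ {x' 0, x' 1, y' 0, y' 1} with hL'
  have hP : IsPair B L L' := by
    refine ⟨hs, hpos, Submodule.disjoint_def.2 fun u hu hu' => ?_⟩
    obtain ⟨a, b, c, d, rfl⟩ := mem_span_four.1 hu
    obtain ⟨a', b', c', d', e⟩ := mem_span_four.1 hu'
    obtain ⟨⟨rfl, rfl, rfl, rfl⟩, -⟩ := hind a b c d (-a') (-b') (-c') (-d') 0 (by rw [e]; module)
    simp
  have ht : ∀ k : ℤ, k • t ∈ L ⊔ L' → k = 0 := fun k hk => by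
    obtain ⟨u, hu, u', hu', e⟩ := Submodule.mem_sup.1 hk
    obtain ⟨a, b, c, d, rfl⟩ := mem_span_four.1 hu
    obtain ⟨a', b', c', d', rfl⟩ := mem_span_four.1 hu'
    have := hind a b c d a' b' c' d' (-k) (by rw [neg_smul, ← e]; abel)
    omega
  have hm : x 0 ∈ L ∧ x 1 ∈ L ∧ y 0 ∈ L ∧ y 1 ∈ L := by
    refine ⟨?_, ?_, ?_, ?_⟩ <;> exact Submodule.subset_span (by simp)
  have hm' : x' 0 ∈ L' ∧ x' 1 ∈ L' ∧ y' 0 ∈ L' ∧ y' 1 ∈ L' := by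
    refine ⟨?_, ?_, ?_, ?_⟩ <;> exact Submodule.subset_span (by simp)
  have hy2 : y 2 = -(y 0 + y 1) := (neg_eq_of_add_eq_zero_right hy).symm
  have hy2' : y' 2 = -(y' 0 + y' 1) := (neg_eq_of_add_eq_zero_right hy').symm
  obtain ⟨f, hf, ef⟩ := exists_frame (L := L) hs hpos hx hy (xn 0) (xn 1) (xn 2) (yn 0) (yn 1)
    (yn 2) (pn 0) (pn 1) (pn 2)
    (fun h => by
      have := hind 1 0 0 (-1) 0 0 0 0 0 (by rw [← h]; module)
      omega)
    (fun h => by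
      have := hind 1 0 1 1 0 0 0 0 0 (by rw [← h, hy2]; module)
      omega) hm
  obtain ⟨f', hf', ef'⟩ := exists_frame (L := L') hs hpos hx' hy' (xn' 0) (xn' 1) (xn' 2) (yn' 0)
    (yn' 1) (yn' 2) (pn' 0) (pn' 1) (pn' 2)
    (fun h => by
      have := hind 0 0 0 0 1 0 0 (-1) 0 (by rw [← h]; module)
      omega)
    (fun h => by
      have := hind 0 0 0 0 1 0 1 1 0 (by rw [← h, hy2']; module)
      omega) hm'
  have n1 := pn 0
  have n1' := pn' 0
  have t1 : t - (x 0 + y 0) ≠ 0 := fun h => by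
    have := hind (-1) 0 (-1) 0 0 0 0 0 1 (by rw [← h]; module)
    omega
  have t1' : t - (x' 0 + y' 0) ≠ 0 := fun h => by
    have := hind 0 0 0 0 (-1) 0 (-1) 0 1 (by rw [← h]; module)
    omega
  have hp := L.add_mem hm.1 hm.2.2.1
  have hp' := L'.add_mem hm'.1 hm'.2.2.1
  generalize x 0 + y 0 = p at *
  generalize x' 0 + y' 0 = p' at *
  have b1 := hpos _ t1
  have b1' := hpos _ t1'
  have b2 := hP.cross_le hp hp' n1 n1'
  have c1 := hs t p
  have c1' := hs t p'
  have c2 := hs p p'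
  simp only [map_sub, map_add, LinearMap.sub_apply, LinearMap.add_apply] at sn b1 b1'
  -- `2 p` is a signed sum of the frame, so `t` cannot be orthogonal to the frame unless it is
  -- orthogonal to `p`.
  have m1 : B t p ≠ 0 → ∃ i, B t (f i) ≠ 0 := fun h => by
    by_contra! h0
    have := congrArg (B t) ef
    simp only [map_sub, map_add, h0] at this
    omega
  have m1' : B t p' ≠ 0 → ∃ i, B t (f' i) ≠ 0 := fun h => by
    by_contra! h0
    have := congrArg (B t) ef'
    simp only [map_sub, map_add, h0] at this
    omega
  -- The norm condition `sn` reads `B t p + B t p' = 2 + B p p'`. As `B p p' ≥ -1`, one summand is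
  -- nonzero; if the frames are orthogonal, `B p p' = 0` and both summands, being at most 1, equal
  -- 1.
  refine not_connected hP hf hf' tn ht ?_ fun h0 => ?_
  · by_cases h : B t p = 0
    · exact Or.inr (m1' (by omega))
    · exact Or.inl (m1 h)
  · have : B p p' = 0 := by
      have e1 := congrArg (fun v => B v (p' + p')) ef
      simp only [ef', map_sub, map_add, LinearMap.sub_apply, LinearMap.add_apply, h0] at e1
      have e2 := congrArg (B p) ef'
      simp only [map_sub, map_add] at e2
      omega
    exact ⟨m1 (by omega), m1' (by omega)⟩

end RootForm

/-! ### Relations between the edge classes of the explicit graph -/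

namespace OrGraph

theorem mk_eq_sum_coedge {V E : Type} [Fintype E] [DecidableEq E] (G : OrGraph V E) (c : E → ℤ) :
    (Submodule.Quotient.mk c : G.Cohomology) = ∑ e, c e • G.coedge e := by
  conv_lhs => rw [pi_eq_sum_univ' c]
  rw [← Submodule.mkQ_apply, map_sum]
  refine Finset.sum_congr rfl fun e _ => ?_
  rw [map_smul, Submodule.mkQ_apply]
  rfl

theorem sum_coedge_eq_zero_iff {V E : Type} [Fintype E] [DecidableEq E] (G : OrGraph V E)
    (c : E → ℤ) :
    ∑ e, c e • G.coedge e = 0 ↔ ∃ f : V → ℤ, ∀ e, f (G.fin e) - f (G.beg e) = c e := by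
  rw [← mk_eq_sum_coedge, Submodule.Quotient.mk_eq_zero, LinearMap.mem_range]
  exact exists_congr fun f => funext_iff

theorem figureGraph_coboundary {f : Fin 13 → ℤ} {c : Fin 21 → ℤ}
    (h : ∀ e, f (figureGraph.fin e) - f (figureGraph.beg e) = c e) :
    (f 1 - f 0 = c 0 ∧ f 2 - f 1 = c 1 ∧ f 3 - f 2 = c 2 ∧ f 0 - f 3 = c 3 ∧ f 6 - f 5 = c 4 ∧
      f 7 - f 6 = c 5 ∧ f 8 - f 7 = c 6) ∧
    (f 5 - f 8 = c 7 ∧ f 4 - f 0 = c 8 ∧ f 2 - f 4 = c 9 ∧ f 9 - f 5 = c 10 ∧ f 7 - f 9 = c 11 ∧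
      f 10 - f 1 = c 12 ∧ f 6 - f 10 = c 13) ∧
    f 11 - f 4 = c 14 ∧ f 9 - f 11 = c 15 ∧ f 12 - f 3 = c 16 ∧ f 8 - f 12 = c 17 ∧
      f 11 - f 10 = c 18 ∧ f 12 - f 11 = c 19 ∧ f 10 - f 12 = c 20 :=
  ⟨⟨h 0, h 1, h 2, h 3, h 4, h 5, h 6⟩, ⟨h 7, h 8, h 9, h 10, h 11, h 12, h 13⟩,
    h 14, h 15, h 16, h 17, h 18, h 19, h 20⟩

theorem figureGraph_coedge_ne_zero (e : Fin 21) : figureGraph.coedge e ≠ 0 := by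
  intro h
  have h1 : ∑ e', (Pi.single e 1 : Fin 21 → ℤ) e' • figureGraph.coedge e' = 0 := by
    rw [← mk_eq_sum_coedge]
    exact h
  obtain ⟨f, hf⟩ := (sum_coedge_eq_zero_iff _ _).1 h1
  have h2 := figureGraph_coboundary hf
  have h3 : ∀ i, (Pi.single e 1 : Fin 21 → ℤ) i = if i = e then 1 else 0 := fun i =>
    Pi.single_apply _ _ _
  simp only [h3] at h2
  clear h3 hf h1 h
  fin_cases e <;> simp at h2 <;> omega

theorem sum_univ_twentyone {M : Type*} [AddCommMonoid M] (F : Fin 21 → M) :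
    ∑ i, F i =
      F 0 + F 1 + F 2 + F 3 + F 4 + F 5 + F 6 + F 7 + F 8 + F 9 + F 10 + F 11 + F 12 + F 13 + F
      14 + F 15 + F 16 + F 17 + F 18 + F 19 + F 20 := by
  simp only [Fin.sum_univ_castSucc, Fin.sum_univ_zero, zero_add]
  rfl

theorem figureGraph_vertex (v : Fin 13) (c : Fin 21 → ℤ)
    (h : ∀ e, ((if figureGraph.fin e = v then 1 else 0) -
      if figureGraph.beg e = v then 1 else 0) = c e) :
    ∑ e, c e • figureGraph.coedge e = 0 :=
  (sum_coedge_eq_zero_iff _ _).2 ⟨fun u => if u = v then 1 else 0, h⟩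

/-- Each relation is, up to sign, the coboundary of the indicator function of one vertex. -/
theorem figureGraph_relations :
    let E := figureGraph.coedge
    (E 0 + E 8 + -E 3 = 0 ∧ -E 1 + -E 9 + E 2 = 0 ∧ E 0 + -E 1 = E 12 ∧ E 8 + -E 9 = E 14 ∧
      -E 3 + E 2 = E 16) ∧
    (E 4 + E 10 + -E 7 = 0 ∧ -E 5 + -E 11 + E 6 = 0 ∧ E 4 + -E 5 = -E 13 ∧ E 10 + -E 11 = -E 15 ∧
      -E 7 + E 6 = -E 17) ∧ E 18 - (E 12 + -E 13) = E 20 := by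
  intro E
  have k0 := figureGraph_vertex 0
    ![-1, 0, 0, 1, 0, 0, 0, 0, -1, 0, 0, 0, 0, 0, 0, 0, 0, 0, 0, 0, 0] (by decide)
  have k2 := figureGraph_vertex 2
    ![0, 1, -1, 0, 0, 0, 0, 0, 0, 1, 0, 0, 0, 0, 0, 0, 0, 0, 0, 0, 0] (by decide)
  have k1 := figureGraph_vertex 1
    ![1, -1, 0, 0, 0, 0, 0, 0, 0, 0, 0, 0, -1, 0, 0, 0, 0, 0, 0, 0, 0] (by decide)
  have k4 := figureGraph_vertex 4
    ![0, 0, 0, 0, 0, 0, 0, 0, 1, -1, 0, 0, 0, 0, -1, 0, 0, 0, 0, 0, 0] (by decide)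
  have k3 := figureGraph_vertex 3
    ![0, 0, 1, -1, 0, 0, 0, 0, 0, 0, 0, 0, 0, 0, 0, 0, -1, 0, 0, 0, 0] (by decide)
  have k5 := figureGraph_vertex 5
    ![0, 0, 0, 0, -1, 0, 0, 1, 0, 0, -1, 0, 0, 0, 0, 0, 0, 0, 0, 0, 0] (by decide)
  have k7 := figureGraph_vertex 7
    ![0, 0, 0, 0, 0, 1, -1, 0, 0, 0, 0, 1, 0, 0, 0, 0, 0, 0, 0, 0, 0] (by decide)
  have k6 := figureGraph_vertex 6
    ![0, 0, 0, 0, 1, -1, 0, 0, 0, 0, 0, 0, 0, 1, 0, 0, 0, 0, 0, 0, 0] (by decide)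
  have k9 := figureGraph_vertex 9
    ![0, 0, 0, 0, 0, 0, 0, 0, 0, 0, 1, -1, 0, 0, 0, 1, 0, 0, 0, 0, 0] (by decide)
  have k8 := figureGraph_vertex 8
    ![0, 0, 0, 0, 0, 0, 1, -1, 0, 0, 0, 0, 0, 0, 0, 0, 0, 1, 0, 0, 0] (by decide)
  have k10 := figureGraph_vertex 10
    ![0, 0, 0, 0, 0, 0, 0, 0, 0, 0, 0, 0, 1, -1, 0, 0, 0, 0, -1, 0, 1] (by decide)
  simp only [sum_univ_twentyone, Matrix.cons_val, zero_smul, one_smul, neg_smul, zero_add,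
    add_zero] at k0 k1 k2 k3 k4 k5 k6 k7 k8 k9 k10
  refine ⟨⟨?_, ?_, ?_, ?_, ?_⟩, ⟨?_, ?_, ?_, ?_, ?_⟩, ?_⟩
  · linear_combination (norm := module) (-1 : ℤ) • k0
  · linear_combination (norm := module) (-1 : ℤ) • k2
  · linear_combination (norm := module) k1
  · linear_combination (norm := module) k4
  · linear_combination (norm := module) k3
  · linear_combination (norm := module) (-1 : ℤ) • k5
  · linear_combination (norm := module) (-1 : ℤ) • k7
  · linear_combination (norm := module) k6
  · linear_combination (norm := module) k9
  · linear_combination (norm := module) k8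
  · linear_combination (norm := module) (-1 : ℤ) • k10

theorem figureGraph_not_hasZEmm : ¬ figureGraph.HasZEmm := by
  rintro ⟨q, hq⟩
  set E := figureGraph.coedge with hE
  set B := QuadraticMap.polarBilin q with hB
  have hn : ∀ e, B (E e) (E e) = 2 := fun e => by
    have := hq.coedge_eq_one e (fun hb => figureGraph_coedge_ne_zero e
      ((figureGraph.coedge_eq_zero_iff e).2 hb))
    rw [hB, QuadraticMap.polarBilin_apply_apply, QuadraticMap.polar_self, this]
    rfl
  have hn' : ∀ e, B (-E e) (-E e) = 2 := fun e => by simp [hn]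
  obtain ⟨⟨r1, r2, r3, r4, r5⟩, ⟨s1, s2, s3, s4, s5⟩, r⟩ := figureGraph_relations
  refine RootForm.not_two_copies (B := B) (x := ![E 0, E 8, -E 3]) (y := ![-E 1, -E 9, E 2])
    (x' := ![E 4, E 10, -E 7]) (y' := ![-E 5, -E 11, E 6]) (t := E 18)
    (fun x y => QuadraticMap.polar_comm _ _ _) (fun x hx => ?_) ?_ ?_ ?_ ?_ ?_ ?_ ?_ ?_ ?_ ?_
    (hn _) ?_ ?_
  · rw [hB, QuadraticMap.polarBilin_apply_apply, QuadraticMap.polar_self, two_smul]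
    linarith [hq.one_le x hx]
  · exact r1
  · exact r2
  · exact s1
  · exact s2
  · intro i; fin_cases i
    exacts [hn _, hn _, hn' _]
  · intro i; fin_cases i
    exacts [hn' _, hn' _, hn _]
  · intro i; fin_cases i
    exacts [hn _, hn _, hn' _]
  · intro i; fin_cases i
    exacts [hn' _, hn' _, hn _]
  · intro i; fin_cases i
    · change B (E 0 + -E 1) (E 0 + -E 1) = 2
      rw [r3, hn]
    · change B (E 8 + -E 9) (E 8 + -E 9) = 2
      rw [r4, hn]
    · change B (-E 3 + E 2) (-E 3 + E 2) = 2
      rw [r5, hn]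
  · intro i; fin_cases i
    · change B (E 4 + -E 5) (E 4 + -E 5) = 2
      rw [s3, hn']
    · change B (E 10 + -E 11) (E 10 + -E 11) = 2
      rw [s4, hn']
    · change B (-E 7 + E 6) (-E 7 + E 6) = 2
      rw [s5, hn']
  · change B (E 18 - (E 0 + -E 1 + (E 4 + -E 5))) (E 18 - (E 0 + -E 1 + (E 4 + -E 5))) = 2
    rw [r3, s3, r, hn]
  -- A relation is a coboundary vanishing on the twelve edges not involved; the resulting linear
  -- equations for the potential `f` kill every coefficient.
  · intro a b c d a' b' c' d' k h
    have h1 : ∑ e, (![a, -c, 0, 0, a', -c', 0, 0, b, -d, b', -d', 0, 0, 0, 0, 0, 0, k, 0, 0] :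
        Fin 21 → ℤ) e • figureGraph.coedge e = 0 := by
      rw [← h]
      simp only [sum_univ_twentyone, Matrix.cons_val, zero_smul, add_zero, ← hE]
      module
    obtain ⟨f, hf⟩ := (sum_coedge_eq_zero_iff _ _).1 h1
    have h2 := figureGraph_coboundary hf
    simp only [Matrix.cons_val] at h2
    omega

end OrGraph

/-! ### Freeness and rank of the cohomology, primitivity of edge classes -/

namespace OrGraph

variable {V E : Type} (G : OrGraph V E)

/-- A function that takes equivalent values at the ends of every edge in `S` takes equivalent values
at joined vertices. -/
theorem Joined.rel_of_edges {S : Set E} {G : OrGraph V E} {r : V → V → Prop} (hr : Equivalence r)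
    (h : ∀ e ∈ S, r (G.beg e) (G.fin e)) {u v : V} (huv : G.Joined S u v) : r u v := by
  unfold Joined at huv
  induction huv with
  | rel a b hab =>
    obtain ⟨e, he, rfl, rfl⟩ := hab
    exact h e he
  | refl => exact hr.refl _
  | symm _ _ _ ih => exact hr.symm ih
  | trans _ _ _ _ _ ih1 ih2 => exact hr.trans ih1 ih2

/-- If `n c = d f`, then by connectedness `f` is constant modulo `n`; dividing `f - f v₀` by `n`
gives a potential for `c`. -/
theorem isTorsionFree_cohomology (hG : G.Connected) : Module.IsTorsionFree ℤ G.Cohomology := by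
  rw [Module.isTorsionFree_iff_smul_eq_zero]
  intro n x hx
  by_contra! hcon
  obtain ⟨hn, hx0⟩ := hcon
  obtain ⟨c, rfl⟩ := Submodule.Quotient.mk_surjective _ x
  apply hx0
  rw [← Submodule.Quotient.mk_smul, Submodule.Quotient.mk_eq_zero] at hx
  obtain ⟨f, hf⟩ := hx
  obtain ⟨⟨v₀⟩, hc⟩ := hG
  have hdvd : ∀ v, n ∣ f v - f v₀ := fun v => by
    refine (hc v₀ v).rel_of_edges (r := fun u v => n ∣ f v - f u) ⟨?_, ?_, ?_⟩ ?_
    · intro u; simp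
    · intro u v h; rw [← neg_sub]; exact (dvd_neg).2 h
    · intro u v w h h'; simpa using dvd_add h' h
    · intro e _
      have := congrFun hf e
      exact ⟨c e, this⟩
  choose h hh using hdvd
  rw [Submodule.Quotient.mk_eq_zero]
  refine ⟨h, funext fun e => ?_⟩
  have h1 := congrFun hf e
  have h2 : f (G.fin e) - f (G.beg e) = n * c e := h1
  have h3 := hh (G.fin e)
  have h4 := hh (G.beg e)
  have h5 : n * (h (G.fin e) - h (G.beg e)) = n * c e := by linear_combination h2 - h3 + h4
  exact mul_left_cancel₀ hn h5

theorem finrank_cohomology [Fintype V] [Fintype E] (hG : G.Connected) :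
    Module.finrank ℤ G.Cohomology + Fintype.card V = Fintype.card E + 1 := by
  have h1 := Submodule.finrank_quotient_add_finrank (LinearMap.range G.coboundary)
  have h2 := Submodule.finrank_quotient_add_finrank (LinearMap.ker G.coboundary)
  rw [(LinearMap.quotKerEquivRange G.coboundary).finrank_eq] at h2
  have h3 : Module.finrank ℤ (LinearMap.ker G.coboundary) = 1 := by
    obtain ⟨⟨v₀⟩, hc⟩ := hG
    have e : LinearMap.ker G.coboundary ≃ₗ[ℤ] ℤ :=
      { toFun := fun f => f.1 v₀
        map_add' := fun _ _ => rfl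
        map_smul' := fun _ _ => rfl
        invFun := fun a => ⟨fun _ => a, by
          rw [LinearMap.mem_ker]
          funext e
          exact sub_self a⟩
        left_inv := fun f => by
          ext v
          refine (hc v₀ v).rel_of_edges (r := fun u v => f.1 u = f.1 v)
            ⟨fun _ => rfl, Eq.symm, Eq.trans⟩ fun e _ => ?_
          have := congrFun f.2 e
          exact (sub_eq_zero.1 this).symm
        right_inv := fun _ => rfl }
    rw [e.finrank_eq, Module.finrank_self]
  simp only [Module.finrank_fintype_fun_eq_card] at h1 h2
  unfold Cohomology
  omega

/-- For a connected graph the image of the boundary map is the kernel of the augmentation, of rank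
`card V - 1`. -/
theorem genus_add_card [Fintype V] [Fintype E] (hG : G.Connected) :
    G.genus + Fintype.card V = Fintype.card E + 1 := by
  have h1 := Submodule.finrank_quotient_add_finrank (LinearMap.ker G.boundary)
  rw [(LinearMap.quotKerEquivRange G.boundary).finrank_eq] at h1
  set aug : (V →₀ ℤ) →ₗ[ℤ] ℤ := Finsupp.linearCombination ℤ fun _ => 1 with haug
  have h2 := Submodule.finrank_quotient_add_finrank (LinearMap.ker aug)
  rw [(LinearMap.quotKerEquivRange aug).finrank_eq] at h2
  obtain ⟨⟨v₀⟩, hc⟩ := hG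
  have h3 : LinearMap.range aug = ⊤ := by
    rw [LinearMap.range_eq_top]
    exact fun a => ⟨Finsupp.single v₀ a, by simp [haug]⟩
  have h4 : LinearMap.range G.boundary = LinearMap.ker aug := by
    apply le_antisymm
    · rintro _ ⟨c, rfl⟩
      rw [LinearMap.mem_ker]
      induction c using Finsupp.induction_linear with
      | zero => simp
      | add f g hf hg => simp [hf, hg]
      | single e a => simp [boundary, haug]
    · intro x hx
      have hj : ∀ v, Finsupp.single v (1 : ℤ) - Finsupp.single v₀ 1 ∈ LinearMap.range G.boundary :=
        fun v => by
          refine (hc v₀ v).rel_of_edges (r := fun u v =>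
            Finsupp.single v (1 : ℤ) - Finsupp.single u 1 ∈ LinearMap.range G.boundary)
            ⟨fun u => by simp, fun {u v} h => by simpa using neg_mem h,
              fun {u v w} h h' => by simpa using add_mem h' h⟩ fun e _ => ?_
          exact ⟨Finsupp.single e 1, by simp [boundary]⟩
      have hx' : x.sum (fun v a => a • (Finsupp.single v (1 : ℤ) - Finsupp.single v₀ 1)) = x := by
        have ha : x.sum (fun _ a => a) = 0 := by
          simpa [haug, Finsupp.linearCombination_apply] using hx
        simp only [smul_sub, Finsupp.smul_single, smul_eq_mul, mul_one, Finsupp.sum_sub,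
          Finsupp.sum_single]
        rw [sub_eq_self, Finsupp.sum, ← Finsupp.single_finsetSum]
        exact (congrArg _ ha).trans (Finsupp.single_zero _)
      rw [← hx']
      exact Submodule.sum_mem _ fun v _ => Submodule.smul_mem _ _ (hj v)
  rw [h3, finrank_top, Module.finrank_self, ← h4] at h2
  simp only [Module.finrank_finsupp_self] at h1 h2
  unfold genus homology
  omega

theorem nonempty_basis [Fintype V] [Fintype E] (hG : G.Connected) :
    Nonempty (Module.Basis (Fin G.genus) ℤ G.Cohomology) := by
  have := G.isTorsionFree_cohomology hG
  have : Module.Free ℤ G.Cohomology := Module.free_of_finite_type_torsion_free'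
  refine ⟨Module.finBasisOfFinrankEq ℤ G.Cohomology ?_⟩
  have h1 := G.finrank_cohomology hG
  have h2 := G.genus_add_card hG
  omega

/-- A cycle through an edge that is not a bridge gives a linear function on the cohomology that
takes the value `1` at this edge. -/
theorem exists_dual_coedge [Fintype E] [DecidableEq E] {e : E} (he : G.coedge e ≠ 0) :
    ∃ φ : G.Cohomology →ₗ[ℤ] ℤ, φ (G.coedge e) = 1 := by
  rw [Ne, coedge_eq_zero_iff, IsBridge, not_not] at he
  -- The relation says that some chain `c` avoiding `e` has boundary `v - u`, tested against
  -- potentials. For the ends of `e`, the difference `e - c` is the desired cycle.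
  have h := he.rel_of_edges (r := fun u v => ∃ c : E → ℤ, c e = 0 ∧
      ∀ f : V → ℤ, ∑ e', c e' * (f (G.fin e') - f (G.beg e')) = f v - f u)
    ⟨fun u => ⟨0, rfl, fun f => by simp⟩, ?_, ?_⟩ ?_
  · obtain ⟨c, h0, hc⟩ := h
    have key : LinearMap.range G.coboundary ≤
        LinearMap.ker (∑ e', (Pi.single e 1 - c : E → ℤ) e' •
          LinearMap.proj (R := ℤ) (φ := fun _ : E => ℤ) e') := by
      rintro _ ⟨f, rfl⟩
      rw [LinearMap.mem_ker]
      simp only [LinearMap.sum_apply, LinearMap.smul_apply, LinearMap.proj_apply, smul_eq_mul,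
        Pi.sub_apply, sub_mul, Finset.sum_sub_distrib]
      have h1 := hc f
      simp only [coboundary, LinearMap.coe_mk, AddHom.coe_mk]
      rw [h1]
      simp [Pi.single_apply]
    refine ⟨Submodule.liftQ _ _ key, ?_⟩
    unfold coedge
    rw [← Submodule.mkQ_apply, Submodule.mkQ_apply, Submodule.liftQ_apply]
    simp [Pi.single_apply, h0]
  · rintro u v ⟨c, h0, hc⟩
    exact ⟨-c, by simp [h0], fun f => by simp [hc f]⟩
  · rintro u v w ⟨c, h0, hc⟩ ⟨c', h0', hc'⟩
    exact ⟨c + c', by simp [h0, h0'], fun f => by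
      simp only [Pi.add_apply, add_mul, Finset.sum_add_distrib, hc f, hc' f]; ring⟩
  · intro e' he'
    exact ⟨Pi.single e' 1, Pi.single_eq_of_ne (Ne.symm he') _, fun f => by simp [Pi.single_apply]⟩

end OrGraph

/-! ### Integral forms and the cones of the central fan -/

section Fan

variable {g : ℕ}

theorem trace_mul_tensor (A : Matrix (Fin g) (Fin g) ℝ) (v : Fin g → ℝ) :
    (A * Matrix.of fun i j => v i * v j).trace = v ⬝ᵥ A *ᵥ v := by
  simp only [Matrix.trace, Matrix.diag_apply, Matrix.mul_apply, Matrix.of_apply, dotProduct,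
    Matrix.mulVec, Finset.mul_sum]
  exact Finset.sum_congr rfl fun i _ => Finset.sum_congr rfl fun j _ => by ring

theorem exists_quadraticForm_of_mem {A : Matrix (Fin g) (Fin g) ℝ} (hA : A ∈ integralPosDef g) :
    ∃ q : QuadraticForm ℤ (Fin g → ℤ), ∀ x : Fin g → ℤ,
      (q x : ℝ) = (fun i => (x i : ℝ)) ⬝ᵥ A *ᵥ fun i => (x i : ℝ) := by
  obtain ⟨hpos, -, hd, ho⟩ := hA
  choose d hd using hd
  choose o ho using ho
  have hsymm : ∀ i j, A j i = A i j := fun i j => by simpa using hpos.1.apply i j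
  -- The upper triangular Gram matrix of the form is integral, although `A` is only half-integral.
  let M : Matrix (Fin g) (Fin g) ℤ :=
    Matrix.of fun i j => if i = j then d i else if i < j then o i j else 0
  have hM : ∀ i j, (M i j : ℝ) + M j i = 2 * A i j := by
    intro i j
    rcases lt_trichotomy i j with h | h | h
    · simp [M, h, h.ne, h.ne', h.not_gt, ho]
    · subst h
      simp [M, hd]
      ring
    · simp [M, h, h.ne, h.ne', h.not_gt, ← ho, hsymm i j]
  refine ⟨(Matrix.toBilin' M).toQuadraticMap, fun x => ?_⟩
  rw [LinearMap.BilinMap.toQuadraticMap_apply, Matrix.toBilin'_apply]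
  simp only [dotProduct, Matrix.mulVec, Finset.mul_sum]
  push_cast
  have h1 : ∑ i, ∑ j, (x i : ℝ) * M i j * x j = ∑ i, ∑ j, (x i : ℝ) * M j i * x j := by
    rw [Finset.sum_comm]
    exact Finset.sum_congr rfl fun i _ => Finset.sum_congr rfl fun j _ => by ring
  have h2 : ∑ i, ∑ j, (x i : ℝ) * M i j * x j + ∑ i, ∑ j, (x i : ℝ) * M j i * x j =
      2 * ∑ i, ∑ j, (x i : ℝ) * (A i j * x j) := by
    simp only [← Finset.sum_add_distrib, Finset.mul_sum]
    refine Finset.sum_congr rfl fun i _ => Finset.sum_congr rfl fun j _ => ?_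
    linear_combination (x i : ℝ) * x j * hM i j
  linarith

/-- A primitive vector has value `1` under some positive definite integral quadratic form. -/
theorem exists_mem_integralPosDef (v φ : Fin g → ℤ) (h : φ ⬝ᵥ v = 1) :
    ∃ A ∈ integralPosDef g, (fun i => (v i : ℝ)) ⬝ᵥ A *ᵥ (fun i => (v i : ℝ)) = 1 := by
  -- This is the form `φ(x)² + |x - φ(x) v|²`: the second term vanishes at `v`, and is `|x|²` where
  -- `φ(x) = 0`.
  let N : Matrix (Fin g) (Fin g) ℤ := Matrix.vecMulVec φ φ +
    (1 - Matrix.vecMulVec v φ)ᵀ * (1 - Matrix.vecMulVec v φ)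
  have hN : N.map (Int.cast : ℤ → ℝ) = Matrix.vecMulVec (fun i => (φ i : ℝ)) (fun i => (φ i : ℝ)) +
      (1 - Matrix.vecMulVec (fun i => (v i : ℝ)) fun i => (φ i : ℝ))ᵀ *
      (1 - Matrix.vecMulVec (fun i => (v i : ℝ)) fun i => (φ i : ℝ)) := by
    ext i j
    simp [N, Matrix.mul_apply, Matrix.vecMulVec_apply, Matrix.one_apply]
  have h' : (fun i => (φ i : ℝ)) ⬝ᵥ (fun i => (v i : ℝ)) = 1 := by
    have := congrArg (Int.cast : ℤ → ℝ) h
    simpa [dotProduct] using this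
  generalize hv' : (fun i => (v i : ℝ)) = v' at *
  generalize hφ' : (fun i => (φ i : ℝ)) = φ' at *
  have hval : ∀ x, x ⬝ᵥ N.map (Int.cast : ℤ → ℝ) *ᵥ x =
      (φ' ⬝ᵥ x) ^ 2 + (x - (φ' ⬝ᵥ x) • v') ⬝ᵥ (x - (φ' ⬝ᵥ x) • v') := by
    intro x
    rw [hN, Matrix.add_mulVec, dotProduct_add, ← Matrix.mulVec_mulVec, 
      Matrix.dotProduct_mulVec x (_)ᵀ, Matrix.vecMul_transpose, Matrix.sub_mulVec,
      Matrix.one_mulVec, Matrix.vecMulVec_mulVec,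
      Matrix.vecMulVec_mulVec]
    simp [dotProduct_comm x φ', sq]
  have hv1 : v' ⬝ᵥ N.map (Int.cast : ℤ → ℝ) *ᵥ v' = 1 := by
    rw [hval, h']; simp
  refine ⟨N.map (Int.cast : ℤ → ℝ), ⟨?_, ?_, fun i => ⟨N i i, rfl⟩, fun i j => ⟨2 * N i j, ?_⟩⟩, hv1⟩
  · refine Matrix.PosDef.of_dotProduct_mulVec_pos ?_ fun x hx => ?_
    · rw [hN]
      refine Matrix.IsHermitian.add ?_ ?_
      · ext i j
        simp [Matrix.vecMulVec_apply, mul_comm]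
      · rw [← Matrix.conjTranspose_eq_transpose_of_trivial]
        exact Matrix.isHermitian_conjTranspose_mul_self _
    · rw [star_trivial, hval]
      by_cases h0 : φ' ⬝ᵥ x = 0
      · simp only [h0, zero_smul, sub_zero]
        have : 0 < x ⬝ᵥ x := by
          have := Matrix.dotProduct_star_self_pos_iff.2 hx
          simpa using this
        positivity
      · have : 0 ≤ (x - (φ' ⬝ᵥ x) • v') ⬝ᵥ (x - (φ' ⬝ᵥ x) • v') :=
          Finset.sum_nonneg fun i _ => mul_self_nonneg _
        positivity
  · intro h0
    rw [h0] at hv1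
    simp at hv1
  · simp

end Fan

namespace OrGraph

/-- If the tensors of all edges lie in one cone of the central cones fan, the graph has a
`ℤ`-edge-minimizing metric. -/
theorem hasZEmm_of_subset_cone {V E : Type} [Fintype E] [DecidableEq E] (G : OrGraph V E) {g : ℕ}
    (b : Module.Basis (Fin g) ℤ G.Cohomology) {σ : Set (Matrix (Fin g) (Fin g) ℝ)}
    (hσ : σ ∈ centralFan g) (hsub : G.coedgeSquares b ⊆ σ) : G.HasZEmm := by
  obtain ⟨F, ⟨A, hAF⟩, hF, rfl⟩ := hσ
  obtain ⟨l, rfl⟩ := hF ⟨A, hAF⟩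
  obtain ⟨ι, _, w, z, hw, hw1, hz, hA⟩ := mem_convexHull_iff_exists_fintype.1 hAF.1
  choose q hq using fun k => exists_quadraticForm_of_mem (hz k)
  have hpos : ∀ k x, x ≠ 0 → 1 ≤ q k x := fun k x hx => by
    have hne : (fun i => (x i : ℝ)) ≠ 0 := fun h => hx (funext fun i => by
      simpa using congrFun h i)
    have := (hz k).1.dotProduct_mulVec_pos hne
    rw [star_trivial, ← hq] at this
    exact_mod_cast this
  -- One form of positive weight, chosen before any edge, serves all edges.
  obtain ⟨k, hk⟩ : ∃ k, 0 < w k := by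
    by_contra! h
    have := Finset.sum_nonpos fun k (_ : k ∈ Finset.univ) => h k
    linarith
  have hone : ∀ e, G.coedge e ≠ 0 → q k (b.repr (G.coedge e)) = 1 := by
    intro e he
    obtain ⟨φ, hφ⟩ := G.exists_dual_coedge he
    set v : Fin g → ℤ := ⇑(b.repr (G.coedge e)) with hv
    have hv0 : v ≠ 0 := fun h => he (b.repr.map_eq_zero_iff.1 (DFunLike.coe_injective h))
    obtain ⟨A', hA', h1⟩ := exists_mem_integralPosDef v (fun i => φ (b i)) (by
      rw [← hφ]
      conv_rhs => rw [← b.sum_repr (G.coedge e)]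
      simp only [map_sum, map_smul, dotProduct, smul_eq_mul, hv]
      exact Finset.sum_congr rfl fun i _ => mul_comm _ _)
    have hle := (hsub ⟨e, he, rfl⟩).2 A hAF A' (subset_convexHull ℝ _ hA')
    rw [trace_mul_tensor A fun i => (v i : ℝ), trace_mul_tensor A' fun i => (v i : ℝ), h1, ← hA,
      Matrix.sum_mulVec, dotProduct_sum] at hle
    simp only [Matrix.smul_mulVec, dotProduct_smul, smul_eq_mul, ← hq] at hle
    -- The weighted mean of the values `q j v ≥ 1` is at most 1, so every value of positive weight
    -- is 1.
    have hge : ∀ j, w j ≤ w j * (q j v : ℝ) := fun j => by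
      have : (1 : ℝ) ≤ q j v := by exact_mod_cast hpos j v hv0
      nlinarith [hw j]
    have hlt : w k * (q k v : ℝ) ≤ w k := by
      by_contra! h
      have := Finset.sum_lt_sum (fun j (_ : j ∈ Finset.univ) => hge j) ⟨k, Finset.mem_univ _, h⟩
      linarith
    have h2 : (q k v : ℝ) ≤ 1 := by
      by_contra! h
      nlinarith
    have h3 : q k v ≤ 1 := by exact_mod_cast h2
    exact le_antisymm h3 (hpos k v hv0)
  have hpos' : ∀ x : G.Cohomology, x ≠ 0 → 1 ≤ q k (b.repr x) := fun x hx =>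
    hpos k _ fun h => hx (b.repr.map_eq_zero_iff.1 (DFunLike.coe_injective h))
  refine ⟨(q k).comp b.equivFun.toLinearMap, fun x hx => ?_, fun e he => ?_, fun x hx => ?_⟩
  · exact lt_of_lt_of_le one_pos (hpos' x hx)
  · exact hone e fun h => he ((G.coedge_eq_zero_iff e).1 h)
  · exact hpos' x hx

end OrGraph

/-! ### Raising the genus by attaching loops -/

namespace OrGraph

/-- The graph obtained by attaching a loop at the vertex `v`. -/
def addLoop {V : Type} {m : ℕ} (G : OrGraph V (Fin m)) (v : V) : OrGraph V (Fin (m + 1)) where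
  beg := Fin.cons v G.beg
  fin := Fin.cons v G.fin

section AddLoop

variable {V : Type} {m : ℕ} (G : OrGraph V (Fin m)) (v : V)

theorem connected_addLoop (hG : G.Connected) : (G.addLoop v).Connected := by
  refine ⟨hG.1, fun a b => (hG.2 a b).rel_of_edges (r := (G.addLoop v).Joined Set.univ)
    (Relation.EqvGen.is_equivalence _) fun e _ => ?_⟩
  exact Relation.EqvGen.rel _ _ ⟨e.succ, trivial, rfl, rfl⟩

theorem isStable_addLoop [DecidableEq V] (hG : G.IsStable) : (G.addLoop v).IsStable := by
  refine ⟨G.connected_addLoop v hG.1, fun u => (hG.2 u).trans ?_⟩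
  have key : ∀ f : Fin m → V, (Finset.univ.filter fun e => f e = u).card ≤
      (Finset.univ.filter fun e => (Fin.cons v f : Fin (m + 1) → V) e = u).card := fun f => by
    rw [← Finset.card_map (Fin.succEmb m)]
    refine Finset.card_le_card fun e he => ?_
    obtain ⟨e', he', rfl⟩ := Finset.mem_map.1 he
    simpa using he'
  exact add_le_add (key _) (key _)

theorem genus_addLoop [Fintype V] (hG : G.Connected) : (G.addLoop v).genus = G.genus + 1 := by
  have h1 := G.genus_add_card hG
  have h2 := (G.addLoop v).genus_add_card (G.connected_addLoop v hG)
  simp only [Fintype.card_fin] at h1 h2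
  omega

/-- Extension of cohomology classes by zero to the new loop. -/
theorem exists_extend_addLoop : ∃ ι : G.Cohomology →ₗ[ℤ] (G.addLoop v).Cohomology,
    Function.Injective ι ∧ ∀ e, ι (G.coedge e) = (G.addLoop v).coedge e.succ := by
  let ι₀ : (Fin m → ℤ) →ₗ[ℤ] (Fin (m + 1) → ℤ) :=
    { toFun := fun c => Fin.cons 0 c
      map_add' := fun c c' => by
        funext i
        refine Fin.cases ?_ (fun _ => ?_) i <;> simp
      map_smul' := fun a c => by
        funext i
        refine Fin.cases ?_ (fun _ => ?_) i <;> simp }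
  have hd : ∀ f, (G.addLoop v).coboundary f = ι₀ (G.coboundary f) := fun f => by
    funext i
    refine Fin.cases ?_ (fun _ => ?_) i <;> simp [ι₀, coboundary, addLoop]
  have hle : LinearMap.range G.coboundary ≤
      (LinearMap.range (G.addLoop v).coboundary).comap ι₀ := by
    rintro _ ⟨f, rfl⟩
    exact ⟨f, hd f⟩
  refine ⟨Submodule.mapQ _ _ ι₀ hle, ?_, fun e => ?_⟩
  · rw [injective_iff_map_eq_zero]
    intro x hx
    obtain ⟨c, rfl⟩ := Submodule.Quotient.mk_surjective _ x
    rw [Submodule.mapQ_apply, Submodule.Quotient.mk_eq_zero] at hx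
    obtain ⟨f, hf⟩ := hx
    rw [hd] at hf
    rw [Submodule.Quotient.mk_eq_zero]
    exact ⟨f, funext fun e => by simpa [ι₀] using congrFun hf e.succ⟩
  · unfold coedge
    rw [Submodule.mapQ_apply]
    congr 1
    funext i
    refine Fin.cases ?_ (fun j => ?_) i
    · simp [ι₀]
    · simp [ι₀, Pi.single_apply]

theorem not_hasZEmm_addLoop (hG : ¬ G.HasZEmm) : ¬ (G.addLoop v).HasZEmm := by
  rintro ⟨q, hq⟩
  obtain ⟨ι, hinj, hι⟩ := G.exists_extend_addLoop v
  have hne : ∀ x, x ≠ 0 → ι x ≠ 0 := fun x hx h => hx (hinj (h.trans (map_zero ι).symm))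
  refine hG ⟨q.comp ι, fun x hx => hq.posDef _ (hne x hx), fun e he => ?_,
    fun x hx => hq.one_le _ (hne x hx)⟩
  rw [QuadraticMap.comp_apply, hι]
  refine hq.coedge_eq_one _ fun h => ?_
  rw [← coedge_eq_zero_iff, ← hι] at h
  exact he ((G.coedge_eq_zero_iff e).1 (hinj (h.trans (map_zero ι).symm)))

end AddLoop

theorem figureGraph_isStable : figureGraph.IsStable := by
  refine ⟨⟨⟨0⟩, ?_⟩, by decide⟩
  have edge : ∀ e, figureGraph.Joined Set.univ (figureGraph.beg e) (figureGraph.fin e) := fun e =>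
    Relation.EqvGen.rel _ _ ⟨e, trivial, rfl, rfl⟩
  have h1 : figureGraph.Joined Set.univ 0 1 := edge 0
  have h2 : figureGraph.Joined Set.univ 0 2 := h1.trans _ _ _ (edge 1)
  have h3 : figureGraph.Joined Set.univ 0 3 := h2.trans _ _ _ (edge 2)
  have h4 : figureGraph.Joined Set.univ 0 4 := edge 8
  have h10 : figureGraph.Joined Set.univ 0 10 := h1.trans _ _ _ (edge 12)
  have h11 : figureGraph.Joined Set.univ 0 11 := h4.trans _ _ _ (edge 14)
  have h12 : figureGraph.Joined Set.univ 0 12 := h3.trans _ _ _ (edge 16)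
  have h6 : figureGraph.Joined Set.univ 0 6 := h10.trans _ _ _ (edge 13)
  have h7 : figureGraph.Joined Set.univ 0 7 := h6.trans _ _ _ (edge 5)
  have h8 : figureGraph.Joined Set.univ 0 8 := h7.trans _ _ _ (edge 6)
  have h5 : figureGraph.Joined Set.univ 0 5 := h8.trans _ _ _ (edge 7)
  have h9 : figureGraph.Joined Set.univ 0 9 := h5.trans _ _ _ (edge 10)
  have h : ∀ v, figureGraph.Joined Set.univ 0 v := by
    intro v
    fin_cases v
    exacts [Relation.EqvGen.refl _, h1, h2, h3, h4, h5, h6, h7, h8, h9, h10, h11, h12]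
  exact fun u v => ((h u).symm _ _).trans _ _ _ (h v)

theorem figureGraph_genus : figureGraph.genus = 9 := by
  have := figureGraph.genus_add_card figureGraph_isStable.1
  simp only [Fintype.card_fin] at this
  omega

theorem exists_stable_not_hasZEmm {g : ℕ} (hg : 9 ≤ g) :
    ∃ (n m : ℕ) (G : OrGraph (Fin n) (Fin m)), G.IsStable ∧ G.genus = g ∧ ¬ G.HasZEmm := by
  induction g, hg using Nat.le_induction with
  | base => exact ⟨13, 21, figureGraph, figureGraph_isStable, figureGraph_genus,
      figureGraph_not_hasZEmm⟩
  | succ g _ ih =>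
    obtain ⟨n, m, G, hs, rfl, hG⟩ := ih
    obtain ⟨v⟩ := hs.1.1
    exact ⟨n, m + 1, G.addLoop v, G.isStable_addLoop v hs, G.genus_addLoop v hs.1,
      G.not_hasZEmm_addLoop v hG⟩

end OrGraph

theorem mainTheorem4 :
    (OrGraph.figureGraph.IsStable ∧ OrGraph.figureGraph.genus = 9 ∧
      ¬ OrGraph.figureGraph.HasZEmm ∧
      Nonempty (Module.Basis (Fin 9) ℤ OrGraph.figureGraph.Cohomology) ∧
      ∀ b : Module.Basis (Fin 9) ℤ OrGraph.figureGraph.Cohomology,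
        ¬ ∃ σ ∈ centralFan 9, OrGraph.figureGraph.coedgeSquares b ⊆ σ) ∧
    ∀ g : ℕ, 9 ≤ g → ∃ (n m : ℕ) (G : OrGraph (Fin n) (Fin m)),
      G.IsStable ∧ G.genus = g ∧
      ¬ G.HasZEmm ∧
      Nonempty (Module.Basis (Fin g) ℤ G.Cohomology) ∧
      ∀ b : Module.Basis (Fin g) ℤ G.Cohomology,
        ¬ ∃ σ ∈ centralFan g, G.coedgeSquares b ⊆ σ := by
  constructor
  · refine ⟨OrGraph.figureGraph_isStable, OrGraph.figureGraph_genus,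
      OrGraph.figureGraph_not_hasZEmm, ?_, ?_⟩
    · rw [← OrGraph.figureGraph_genus]
      exact OrGraph.figureGraph.nonempty_basis OrGraph.figureGraph_isStable.1
    · rintro b ⟨σ, hσ, hsub⟩
      exact OrGraph.figureGraph_not_hasZEmm
        (OrGraph.figureGraph.hasZEmm_of_subset_cone b hσ hsub)
  · intro g hg
    obtain ⟨n, m, G, hs, rfl, hG⟩ := OrGraph.exists_stable_not_hasZEmm hg
    refine ⟨n, m, G, hs, rfl, hG, G.nonempty_basis hs.1, ?_⟩
    rintro b ⟨σ, hσ, hsub⟩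
    exact hG (G.hasZEmm_of_subset_cone b hσ hsub)
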